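/- Let $p_1,\dots,p_d\in\mathbb{C}[x_1,\dots,x_d]$, and for $1\le k\le d$ let $W_k(\mathbf{x})=V_{k0}-\sum_{j=1}^d x_jV_{kj}$ with $V_{kj}\in\mathbb{C}^{n_k\times n_k}$ be a determinantal representation, $\det W_k=p_k$. Let $\mathbf{x}^*\in\mathbb{C}^d$ be a simple root of $p=(p_1,\dots,p_d)$: $p(\mathbf{x}^*)=0$ and the Jacobian $J(\mathbf{x}^*)=(\partial p_k/\partial x_j(\mathbf{x}^*))_{k,j}$ is invertible. Let $\mathbf{u}_k,\mathbf{v}_k\in\mathbb{C}^{n_k}$ be vectors of Euclidean norm one with $\mathbf{u}_k^\top W_k(\mathbf{x}^*)=0$ and $W_k(\mathbf{x}^*)\mathbf{v}_k=0$, and let $B_0=(\mathbf{u}_k^\top V_{kj}\mathbf{v}_k)_{k,j}\in\mathbb{C}^{d\times d}$. Let $\Delta_0=\sum_{s\in S_d}\operatorname{sgn}(s)\,V_{1,s(1)}\otimes\cdots\otimes V_{d,s(d)}$ be the operator determinant of the block array $(V_{kj})_{k,j=1}^d$, and let $\Delta_i$ be the operator determinant of the array in which the $i$-th block column is replaced by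 $(V_{k0})_k$. For a generalized eigenproblem $A\mathbf{z}=\lambda B\mathbf{z}$, an eigenvalue $\lambda^*$ is called simple if it is a root of multiplicity one of $\det(A-\lambda B)$, and its normwise absolute condition number is $$\kappa_{\mathrm{eig}}(\lambda^*)=\lim_{r\to0^+}\limsup_{\epsilon\to0^+}\ \sup\frac{|\delta|}{\epsilon},$$ where the supremum is over all $\delta$ with $|\delta|\le r$ for which there are matrices $\Delta A,\Delta B$ with $\|\Delta A\|_2,\|\Delta B\|_2\le\epsilon$, a unit vector $\mathbf{z}$ with $(A-\lambda^*B)\mathbf{z}=0$ and a vector $\Delta\mathbf{z}$ with $\|\Delta\mathbf{z}\|_2\le r$, $\mathbf{z}+\Delta\mathbf{z}\ne0$ and $\big((A+\Delta A)-(\lambda^*+\delta)(B+\Delta B)\big)(\mathbf{z}+\Delta\mathbf{z})=0$. Then each $W_k(\mathbf{x}^*)$ has exactly $n_k-1$ nonzero singular values $\sigma^{(k)}_1(\mathbf{x}^*),\dots,\sigma^{(k)}_{n_k-1}(\mathbf{x}^*)$, the matrix $B_0$ is invertible, and $$|\det B_0|^{-1}=\frac{\prod_{k=1}^d\prod_{j=1}^{n_k-1}\sigma_j^{(k)}(\mathbf{x}^*)}{|\det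 J(\mathbf{x}^*)|}.$$ Moreover, for every $1\le i\le d$: 1. $\mathbf{y}=\mathbf{u}_1\otimes\cdots\otimes\mathbf{u}_d$ and $\mathbf{z}=\mathbf{v}_1\otimes\cdots\otimes\mathbf{v}_d$ are a left and a right eigenvector of the problem $(\Delta_i-\lambda\Delta_0)\mathbf{z}=0$ at $\lambda=x_i^*$, and $$\frac{\|\mathbf{y}\|_2\|\mathbf{z}\|_2}{|\mathbf{y}^\top\Delta_0\mathbf{z}|}(1+|x_i^*|)=|\det B_0|^{-1}(1+|x_i^*|).$$ 2. If $x_i^*$ is a simple eigenvalue of $(\Delta_i-\lambda\Delta_0)\mathbf{z}=0$, then its condition number is $$\kappa_{\mathrm{eig}}(x_i^*)=|\det B_0|^{-1}(1+|x_i^*|)=\frac{\prod_{k=1}^d\prod_{j=1}^{n_k-1}\sigma_j^{(k)}(\mathbf{x}^*)}{|\det J(\mathbf{x}^*)|}(1+|x_i^*|).$$ 3. If $\Delta_0$ is invertible and no other root of $p$ has the same $i$-th coordinate as $\mathbf{x}^*$, then $x_i^*$ is a simple eigenvalue of $(\Delta_i-\lambda\Delta_0)\mathbf{z}=0$. -/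

import Mathlib

open scoped ENNReal Topology

noncomputable section

namespace OpDet

section Pencil

variable {ι : Type*} [Fintype ι] [DecidableEq ι]

/-- The Euclidean norm of a coordinate vector. -/
def vecNorm (x : ι → ℂ) : ℝ := ‖WithLp.toLp 2 x‖

/-- The spectral norm of a square matrix. -/
def specNorm (A : Matrix ι ι ℂ) : ℝ := ‖Matrix.toEuclideanCLM (n := ι) (𝕜 := ℂ) A‖

/-- The singular values of a square matrix in decreasing order, indexed from `0`. -/
def singVal (A : Matrix ι ι ℂ) (j : ℕ) : ℝ := (Matrix.toEuclideanLin A).singularValues j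

/-- `x` is a right eigenvector of the generalized eigenproblem `A x = lam B x`. -/
def IsRightEigenvector (A B : Matrix ι ι ℂ) (lam : ℂ) (x : ι → ℂ) : Prop :=
  x ≠ 0 ∧ (A - lam • B).mulVec x = 0

/-- `y` is a left eigenvector: `yᵀ (A - lam B) = 0` (transpose, no conjugation). -/
def IsLeftEigenvector (A B : Matrix ι ι ℂ) (lam : ℂ) (y : ι → ℂ) : Prop :=
  y ≠ 0 ∧ Matrix.vecMul y (A - lam • B) = 0

/-- The characteristic polynomial `det (A - t B)` of the pencil, as a polynomial in `t`. -/
def pencilPoly (A B : Matrix ι ι ℂ) : Polynomial ℂ :=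
  (A.map Polynomial.C - (Polynomial.X : Polynomial ℂ) • B.map Polynomial.C).det

/-- `lam` is a simple eigenvalue: a root of multiplicity one of `det (A - t B)`.
The pencil is then regular, since the zero polynomial has root multiplicity `0` in Mathlib. -/
def IsSimpleEigenvalue (A B : Matrix ι ι ℂ) (lam : ℂ) : Prop :=
  (pencilPoly A B).rootMultiplicity lam = 1

/-- The eigenvalue changes `δ` that perturbations `ΔA`, `ΔB` of spectral norm at most `ε` can
produce at the eigenvalue `lam`, together with a perturbation `Δx` of a unit eigenvector `x`.
Both `δ` and `Δx` are kept within `r`, so that `lam + δ` is a perturbation of `lam` and not of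
another eigenvalue. -/
def eigChanges (A B : Matrix ι ι ℂ) (lam : ℂ) (r ε : ℝ) : Set ℂ :=
  {δ | ∃ (ΔA ΔB : Matrix ι ι ℂ) (x Δx : ι → ℂ),
    specNorm ΔA ≤ ε ∧ specNorm ΔB ≤ ε ∧
    vecNorm x = 1 ∧ IsRightEigenvector A B lam x ∧
    vecNorm Δx ≤ r ∧ ‖δ‖ ≤ r ∧
    IsRightEigenvector (A + ΔA) (B + ΔB) (lam + δ) (x + Δx)}

/-- The normwise absolute condition number of the eigenvalue `lam` of `A x = lam B x`:
the limsup as `ε → 0⁺` of the supremum of `|δ| / ε` over all changes `δ` of the eigenvalue under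
perturbations of size at most `ε`, for changes of the eigenpair that are themselves small
(the value is nondecreasing in `r`, so the infimum is the limit `r → 0⁺`). -/
def eigCond (A B : Matrix ι ι ℂ) (lam : ℂ) : ℝ≥0∞ :=
  ⨅ (r : ℝ) (_ : 0 < r),
    Filter.limsup (fun ε : ℝ => ⨆ δ ∈ eigChanges A B lam r ε, ENNReal.ofReal (‖δ‖ / ε))
      (𝓝[>] (0 : ℝ))

/-- The expression `‖y‖ ‖x‖ / |yᵀ B x| * (1 + |lam|)` at a left eigenvector `y` and a right
eigenvector `x`. -/
def eigCondAt (B : Matrix ι ι ℂ) (lam : ℂ) (y x : ι → ℂ) : ℝ :=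
  vecNorm y * vecNorm x / ‖y ⬝ᵥ B.mulVec x‖ * (1 + ‖lam‖)

end Pencil

section Multiparameter

variable {d : ℕ} {n : Fin d → ℕ}

/-- The linear matrix polynomial `V₀ - ∑ j, x_j V_j` over `ℂ[x_1, …, x_d]`. -/
def linPoly {m : ℕ} (V₀ : Matrix (Fin m) (Fin m) ℂ) (V : Fin d → Matrix (Fin m) (Fin m) ℂ) :
    Matrix (Fin m) (Fin m) (MvPolynomial (Fin d) ℂ) :=
  V₀.map MvPolynomial.C -
    ∑ j, (MvPolynomial.X j : MvPolynomial (Fin d) ℂ) • (V j).map MvPolynomial.C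

/-- The value `V₀ - ∑ j, x_j V_j` of the linear matrix polynomial at a point. -/
def linEval {m : ℕ} (V₀ : Matrix (Fin m) (Fin m) ℂ) (V : Fin d → Matrix (Fin m) (Fin m) ℂ)
    (x : Fin d → ℂ) : Matrix (Fin m) (Fin m) ℂ :=
  V₀ - ∑ j, x j • V j

/-- The Kronecker product of a family of square matrices, with rows and columns indexed by
multi-indices. -/
def kron (M : (k : Fin d) → Matrix (Fin (n k)) (Fin (n k)) ℂ) :
    Matrix ((k : Fin d) → Fin (n k)) ((k : Fin d) → Fin (n k)) ℂ :=
  Matrix.of fun a b => ∏ k, M k (a k) (b k)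

/-- The Kronecker product of a family of vectors. -/
def kronVec (v : (k : Fin d) → Fin (n k) → ℂ) : ((k : Fin d) → Fin (n k)) → ℂ :=
  fun a => ∏ k, v k (a k)

/-- The operator determinant of the block array `M k j`: the Leibniz formula with products
replaced by Kronecker products. -/
def opDet (M : (k : Fin d) → Fin d → Matrix (Fin (n k)) (Fin (n k)) ℂ) :
    Matrix ((k : Fin d) → Fin (n k)) ((k : Fin d) → Fin (n k)) ℂ :=
  ∑ s : Equiv.Perm (Fin d), ((Equiv.Perm.sign s : ℤ) : ℂ) • kron fun k => M k (s k)

/-- `Δ_i`: the operator determinant with the `i`-th block column replaced by `V₀`. -/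
def opDetCol (V₀ : (k : Fin d) → Matrix (Fin (n k)) (Fin (n k)) ℂ)
    (V : (k : Fin d) → Fin d → Matrix (Fin (n k)) (Fin (n k)) ℂ) (i : Fin d) :
    Matrix ((k : Fin d) → Fin (n k)) ((k : Fin d) → Fin (n k)) ℂ :=
  opDet fun k => Function.update (V k) i (V₀ k)

/-- The matrix `B₀` with entries `u_kᵀ V_{kj} v_k`. -/
def matB₀ (V : (k : Fin d) → Fin d → Matrix (Fin (n k)) (Fin (n k)) ℂ)
    (u v : (k : Fin d) → Fin (n k) → ℂ) : Matrix (Fin d) (Fin d) ℂ :=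
  Matrix.of fun k j => u k ⬝ᵥ (V k j).mulVec (v k)

/-- The Jacobian matrix of a polynomial system at a point. -/
def jacobian (p : Fin d → MvPolynomial (Fin d) ℂ) (x : Fin d → ℂ) : Matrix (Fin d) (Fin d) ℂ :=
  Matrix.of fun k j => MvPolynomial.eval x (MvPolynomial.pderiv j (p k))

/-- `x` is a root of the polynomial system. -/
def IsRoot (p : Fin d → MvPolynomial (Fin d) ℂ) (x : Fin d → ℂ) : Prop :=
  ∀ k, MvPolynomial.eval x (p k) = 0

/-- `x` is a simple root: a root with invertible Jacobian. -/
def IsSimpleRoot (p : Fin d → MvPolynomial (Fin d) ℂ) (x : Fin d → ℂ) : Prop :=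
  IsRoot p x ∧ (jacobian p x).det ≠ 0

end Multiparameter

end OpDet

end

namespace OpDet

open Matrix

/-! ### Matrices with one-dimensional kernel, their adjugates, and Jacobi's formula -/

section LinearAlgebra

variable {ι : Type*} [Fintype ι] [DecidableEq ι]

/-! Write `W_k` for `W_k(x)`. By Jacobi's formula the `(k, j)` entry of the Jacobian is `-tr (adj
W_k * V_kj)`. Invertibility of the Jacobian forces `adj W_k ≠ 0`, so `ker W_k` is a line and `adj
W_k = c_k v_k u_kᵀ` with `c_k ≠ 0`. Hence the Jacobian is `diag (-c_k) * B₀` (`det_jacobian`), and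
comparing the linear coefficient of the characteristic polynomial of `W_kᴴ W_k` with `adj (W_kᴴ
W_k)` gives `|c_k|` as the product of the nonzero singular values (`singVal_of_adjugate_ne_zero`).

Multilinearity turns `Δ_i - x_i Δ₀` into the operator determinant with column `i` replaced by `W_k`
(`opDetCol_sub_smul`); every Leibniz term then kills the Kronecker vectors, while `yᵀ Δ₀ z = det
B₀`. For a simple eigenvalue with unit eigenvectors, pairing the perturbed equation with `y` bounds
the condition number above (`eigCond_le`), and an explicit rank-one perturbation attains the bound
(`le_eigCond`).

For simplicity, the matrices `Γ_j = Δ₀⁻¹ Δ_j` commute (`opDetQuot_commute`) and their joint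
eigenvalues are roots of `p`. If the `x_i`-eigenspace of `Γ_i` met the annihilator of `yᵀ Δ₀`
nontrivially, it would contain a joint eigenvector there; uniqueness of the root makes that vector a
multiple of `z`, contradicting `yᵀ Δ₀ z ≠ 0`. So the eigenspace is a line, and `yᵀ Δ₀ z ≠ 0`
upgrades this to algebraic simplicity. -/

/-- A nonzero entry `(i, j)` of the adjugate is the determinant of `A` with row `j` replaced by
`e_i`, so a kernel vector is determined by its `i`-th coordinate. -/
theorem eq_smul_of_adjugate_ne_zero {K : Type*} [Field K] {A : Matrix ι ι K}
    (hA : A.adjugate ≠ 0) {v : ι → K} (hv0 : v ≠ 0) (hv : A *ᵥ v = 0) {w : ι → K}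
    (hw : A *ᵥ w = 0) : ∃ c : K, w = c • v := by
  obtain ⟨i, j, hij⟩ : ∃ i j, A.adjugate i j ≠ 0 := by
    by_contra! h
    exact hA (by ext i j; exact h i j)
  rw [adjugate_apply] at hij
  have key : ∀ w : ι → K, A *ᵥ w = 0 → w i = 0 → w = 0 := by
    intro w hw hwi
    refine eq_zero_of_mulVec_eq_zero hij ?_
    ext k
    by_cases hk : k = j
    · subst hk
      simp [mulVec, hwi]
    · simpa [mulVec, updateRow_ne hk] using congrFun hw k
  have hvi : v i ≠ 0 := fun h => hv0 (key v hv h)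
  refine ⟨w i / v i, ?_⟩
  rw [← sub_eq_zero]
  refine key _ ?_ ?_
  · rw [mulVec_sub, mulVec_smul, hw, hv, smul_zero, sub_zero]
  · simp [hvi]

theorem eq_smul_of_adjugate_ne_zero_left {K : Type*} [Field K] {A : Matrix ι ι K}
    (hA : A.adjugate ≠ 0) {u : ι → K} (hu0 : u ≠ 0) (hu : u ᵥ* A = 0) {w : ι → K}
    (hw : w ᵥ* A = 0) : ∃ c : K, w = c • u := by
  refine eq_smul_of_adjugate_ne_zero (A := Aᵀ) ?_ hu0 ?_ ?_
  · rw [← adjugate_transpose]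
    simpa using hA
  · rw [mulVec_transpose, hu]
  · rw [mulVec_transpose, hw]

/-- Take `u j ≠ 0` and `v i ≠ 0`. If the `(i, j)` entry vanished, some `w ≠ 0` with `w i = 0` would
be killed by every row but the `j`-th; the relation `u` then kills that row too, so `w` is a
multiple of `v`, impossible as `w i = 0`. -/
theorem adjugate_ne_zero_of_ker {K : Type*} [Field K] {A : Matrix ι ι K} {u v : ι → K}
    (hu0 : u ≠ 0) (hv0 : v ≠ 0) (hu : u ᵥ* A = 0)
    (hker : ∀ w, A *ᵥ w = 0 → ∃ c : K, w = c • v) : A.adjugate ≠ 0 := by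
  obtain ⟨j, hj⟩ := Function.ne_iff.1 hu0
  obtain ⟨i, hi⟩ := Function.ne_iff.1 hv0
  intro h
  have hdet : (A.updateRow j (Pi.single i 1)).det = 0 := by
    rw [← adjugate_apply, h, Matrix.zero_apply]
  obtain ⟨w, hw0, hw⟩ := exists_mulVec_eq_zero_iff.2 hdet
  have hwi : w i = 0 := by
    simpa [mulVec] using congrFun hw j
  have hne : ∀ k, k ≠ j → (A *ᵥ w) k = 0 := fun k hk => by
    simpa [mulVec, updateRow_ne hk] using congrFun hw k
  have hAw : A *ᵥ w = 0 := by
    have h1 : u ⬝ᵥ A *ᵥ w = 0 := by rw [dotProduct_mulVec, hu, zero_dotProduct]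
    have h2 : u ⬝ᵥ A *ᵥ w = u j * (A *ᵥ w) j := by
      refine Finset.sum_eq_single j (fun k _ hk => ?_) (by simp)
      rw [hne k hk, mul_zero]
    ext k
    by_cases hk : k = j
    · subst hk
      exact (mul_eq_zero.1 (h2.symm.trans h1)).resolve_left hj
    · exact hne k hk
  obtain ⟨c, rfl⟩ := hker w hAw
  have hc : c = 0 := (mul_eq_zero.1 (by simpa using hwi)).resolve_right hi
  exact hw0 (by simp [hc])

/-- Since `A * adj A = 0`, each column of `adj A` is a multiple of `v`; since `adj A * A = 0`, the
row of multipliers is a left null vector. -/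
theorem exists_adjugate_eq_smul {K : Type*} [Field K] {A : Matrix ι ι K}
    (hA : A.adjugate ≠ 0) {u v : ι → K} (hu0 : u ≠ 0) (hv0 : v ≠ 0)
    (hu : u ᵥ* A = 0) (hv : A *ᵥ v = 0) :
    ∃ c : K, c ≠ 0 ∧ A.adjugate = c • vecMulVec v u := by
  have hdet : A.det = 0 := exists_mulVec_eq_zero_iff.1 ⟨v, hv0, hv⟩
  have hcol : ∀ j, ∃ c : K, A.adjugate.col j = c • v := fun j => by
    refine eq_smul_of_adjugate_ne_zero hA hv0 hv ?_
    ext k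
    have := congrFun (congrFun (mul_adjugate A) k) j
    rwa [hdet, zero_smul] at this
  choose q hq using hcol
  have hadj : A.adjugate = vecMulVec v q := by
    ext i j
    simpa [vecMulVec_apply, mul_comm] using congrFun (hq j) i
  obtain ⟨i, hi⟩ := Function.ne_iff.1 hv0
  have hqA : q ᵥ* A = 0 := by
    have h := adjugate_mul A
    rw [hdet, zero_smul, hadj, vecMulVec_mul] at h
    ext k
    have := congrFun (congrFun h i) k
    rw [vecMulVec_apply] at this
    exact (mul_eq_zero.1 this).resolve_left hi
  obtain ⟨c, rfl⟩ := eq_smul_of_adjugate_ne_zero_left hA hu0 hu hqA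
  have hadj' : A.adjugate = c • vecMulVec v u := by
    rw [hadj, vecMulVec_smul]
  refine ⟨c, ?_, hadj'⟩
  rintro rfl
  exact hA (by rw [hadj', zero_smul])

/-- Bordering a matrix with one-dimensional kernel by a rank-one matrix makes it invertible. -/
theorem det_add_vecMulVec_ne_zero {K : Type*} [Field K] {A : Matrix ι ι K} {u v a b : ι → K}
    (hua : u ⬝ᵥ a ≠ 0) (hbv : b ⬝ᵥ v ≠ 0) (hu : u ᵥ* A = 0)
    (hker : ∀ w, A *ᵥ w = 0 → ∃ c : K, w = c • v) : (A + vecMulVec a b).det ≠ 0 := by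
  intro h
  obtain ⟨w, hw0, hw⟩ := exists_mulVec_eq_zero_iff.2 h
  rw [add_mulVec, vecMulVec_mulVec] at hw
  have hbw : b ⬝ᵥ w = 0 := by
    have := congrArg (fun z => u ⬝ᵥ z) hw
    simp only [dotProduct_add, dotProduct_mulVec, hu, zero_dotProduct, zero_add,
      dotProduct_zero] at this
    simpa [hua] using this
  have hAw : A *ᵥ w = 0 := by simpa [hbw] using hw
  obtain ⟨c, rfl⟩ := hker w hAw
  rw [dotProduct_smul, smul_eq_mul] at hbw
  have hc : c = 0 := (mul_eq_zero.1 hbw).resolve_right hbv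
  exact hw0 (by simp [hc])

theorem exists_mulVec_eq_of_dotProduct_eq_zero {K : Type*} [Field K] {A : Matrix ι ι K}
    {u v a b : ι → K}
    (hua : u ⬝ᵥ a ≠ 0) (hbv : b ⬝ᵥ v ≠ 0) (hu : u ᵥ* A = 0)
    (hker : ∀ w, A *ᵥ w = 0 → ∃ c : K, w = c • v) {r : ι → K} (hr : u ⬝ᵥ r = 0) :
    ∃ w, A *ᵥ w = r := by
  have hN := det_add_vecMulVec_ne_zero hua hbv hu hker
  refine ⟨(A + vecMulVec a b)⁻¹ *ᵥ r, ?_⟩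
  set w := (A + vecMulVec a b)⁻¹ *ᵥ r
  have hw : (A + vecMulVec a b) *ᵥ w = r := by
    rw [mulVec_mulVec, mul_nonsing_inv _ (isUnit_iff_ne_zero.2 hN), one_mulVec]
  rw [add_mulVec, vecMulVec_mulVec] at hw
  have hbw : b ⬝ᵥ w = 0 := by
    have := congrArg (fun z => u ⬝ᵥ z) hw
    simp only [dotProduct_add, dotProduct_mulVec, hu, zero_dotProduct, zero_add, hr] at this
    simpa [hua] using this
  simpa [hbw] using hw

/-- `C` is the inverse of the bordered matrix, which agrees with `A` on the range of the projection
`1 - v bᵀ` along `v`. -/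
theorem exists_mul_eq_one_sub_vecMulVec {K : Type*} [Field K] {A : Matrix ι ι K}
    {u v a b : ι → K}
    (hua : u ⬝ᵥ a ≠ 0) (hbv : b ⬝ᵥ v = 1) (hu : u ᵥ* A = 0) (hv : A *ᵥ v = 0)
    (hker : ∀ w, A *ᵥ w = 0 → ∃ c : K, w = c • v) :
    ∃ C : Matrix ι ι K, C * A = 1 - vecMulVec v b := by
  have hN := det_add_vecMulVec_ne_zero hua (by rw [hbv]; exact one_ne_zero) hu hker
  refine ⟨(A + vecMulVec a b)⁻¹, ?_⟩
  have h : (A + vecMulVec a b) * (1 - vecMulVec v b) = A := by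
    rw [mul_sub, mul_one, mul_vecMulVec, add_mulVec, vecMulVec_mulVec, hv, hbv]
    simp
  have h' := congrArg (fun M => (A + vecMulVec a b)⁻¹ * M) h
  rw [← h', ← mul_assoc, nonsing_inv_mul _ (isUnit_iff_ne_zero.2 hN), one_mul]

theorem derivation_prod {R A κ : Type*} [CommSemiring R] [CommSemiring A] [Algebra R A]
    [DecidableEq κ] (D : Derivation R A A) (s : Finset κ) (f : κ → A) :
    D (∏ i ∈ s, f i) = ∑ i ∈ s, (∏ j ∈ s.erase i, f j) * D (f i) := by
  induction s using Finset.induction_on with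
  | empty => simp
  | insert a s ha ih =>
    rw [Finset.prod_insert ha, D.leibniz, ih, Finset.sum_insert ha, Finset.erase_insert ha,
      smul_eq_mul, smul_eq_mul, Finset.mul_sum, add_comm]
    congr 1
    refine Finset.sum_congr rfl fun i hi => ?_
    have hia : a ≠ i := fun h => ha (h ▸ hi)
    rw [Finset.erase_insert_of_ne hia, Finset.prod_insert (by simp [ha]), mul_assoc]

/-- **Jacobi's formula** for an arbitrary derivation. -/
theorem derivation_det {R A : Type*} [CommRing R] [CommRing A] [Algebra R A]
    (D : Derivation R A A) (M : Matrix ι ι A) :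
    D M.det = (M.adjugate * M.map D).trace := by
  have h1 : ∀ i, (M.adjugate * M.map D) i i = (M.updateCol i fun k => D (M k i)).det := by
    intro i
    rw [← cramer_apply, cramer_eq_adjugate_mulVec]
    rfl
  simp only [trace, diag_apply, h1]
  simp only [det_apply', map_sum]
  rw [Finset.sum_comm]
  refine Finset.sum_congr rfl fun s _ => ?_
  have h2 : D (((Equiv.Perm.sign s : ℤ) : A) * ∏ i, M (s i) i) =
      ((Equiv.Perm.sign s : ℤ) : A) * D (∏ i, M (s i) i) := by
    rw [D.leibniz]
    simp
  rw [h2, derivation_prod, Finset.mul_sum]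
  refine Finset.sum_congr rfl fun i _ => ?_
  congr 1
  rw [← Finset.prod_erase_mul _ _ (Finset.mem_univ i)]
  congr 1
  · refine Finset.prod_congr rfl fun j hj => ?_
    rw [updateCol_ne (Finset.ne_of_mem_erase hj)]
  · simp

theorem map_trace_adjugate_mul {R S : Type*} [CommRing R] [CommRing S] (f : R →+* S)
    (M N : Matrix ι ι R) :
    f (M.adjugate * N).trace = ((M.map f).adjugate * N.map f).trace := by
  rw [← f.mapMatrix_apply, ← f.mapMatrix_apply, ← RingHom.map_adjugate, ← map_mul]
  simp only [trace, map_sum]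
  rfl

end LinearAlgebra

/-! ### Euclidean and spectral norms -/

section Norms

variable {ι : Type*} [Fintype ι]

theorem vecNorm_sq (x : ι → ℂ) : ((vecNorm x ^ 2 : ℝ) : ℂ) = star x ⬝ᵥ x := by
  rw [vecNorm, EuclideanSpace.norm_sq_eq]
  simp [dotProduct, Complex.conj_mul']

theorem star_dotProduct_self {x : ι → ℂ} (hx : vecNorm x = 1) : star x ⬝ᵥ x = 1 := by
  rw [← vecNorm_sq, hx]
  simp

theorem dotProduct_star_self {x : ι → ℂ} (hx : vecNorm x = 1) : x ⬝ᵥ star x = 1 := by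
  rw [dotProduct_comm, star_dotProduct_self hx]

theorem ne_zero_of_vecNorm {x : ι → ℂ} (hx : vecNorm x = 1) : x ≠ 0 := by
  rintro rfl
  simp [vecNorm] at hx

theorem vecNorm_nonneg (x : ι → ℂ) : 0 ≤ vecNorm x := norm_nonneg _

theorem vecNorm_add_le (x y : ι → ℂ) : vecNorm (x + y) ≤ vecNorm x + vecNorm y :=
  norm_add_le (WithLp.toLp 2 x) (WithLp.toLp 2 y)

theorem vecNorm_smul (c : ℂ) (x : ι → ℂ) : vecNorm (c • x) = ‖c‖ * vecNorm x :=
  norm_smul c (WithLp.toLp 2 x)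

theorem vecNorm_star (x : ι → ℂ) : vecNorm (star x) = vecNorm x := by
  simp [vecNorm, EuclideanSpace.norm_eq]

theorem vecNorm_sub_le_add (x y : ι → ℂ) : vecNorm x - vecNorm y ≤ vecNorm (x + y) := by
  have := norm_sub_norm_le (WithLp.toLp 2 x) (-WithLp.toLp 2 y)
  simpa [vecNorm] using this

theorem norm_dotProduct_le (x y : ι → ℂ) : ‖x ⬝ᵥ y‖ ≤ vecNorm x * vecNorm y := by
  have := norm_inner_le_norm (𝕜 := ℂ) (WithLp.toLp 2 (star x)) (WithLp.toLp 2 y)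
  rw [EuclideanSpace.inner_toLp_toLp] at this
  rw [← vecNorm_star x]
  simpa [dotProduct_comm, vecNorm] using this

variable [DecidableEq ι]

theorem specNorm_nonneg (A : Matrix ι ι ℂ) : 0 ≤ specNorm A := norm_nonneg _

theorem vecNorm_mulVec_le (A : Matrix ι ι ℂ) (x : ι → ℂ) :
    vecNorm (A *ᵥ x) ≤ specNorm A * vecNorm x :=
  (toEuclideanCLM (n := ι) (𝕜 := ℂ) A).le_opNorm (WithLp.toLp 2 x)

theorem specNorm_smul (c : ℂ) (A : Matrix ι ι ℂ) : specNorm (c • A) = ‖c‖ * specNorm A := by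
  rw [specNorm, map_smul, norm_smul, specNorm]

theorem specNorm_vecMulVec_le (a b : ι → ℂ) :
    specNorm (vecMulVec a b) ≤ vecNorm a * vecNorm b := by
  refine ContinuousLinearMap.opNorm_le_bound _ (mul_nonneg (norm_nonneg _) (norm_nonneg _))
    fun x => ?_
  have h : toEuclideanCLM (n := ι) (𝕜 := ℂ) (vecMulVec a b) x =
      WithLp.toLp 2 ((b ⬝ᵥ x.ofLp) • a) := by
    ext k
    simp [vecMulVec_mulVec, mul_comm]
  rw [h]
  change vecNorm _ ≤ _
  rw [vecNorm_smul, mul_assoc, mul_comm]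
  exact mul_le_mul_of_nonneg_left (norm_dotProduct_le b x.ofLp) (norm_nonneg _)

end Norms

/-! ### Singular values and the adjugate -/

section SingularValues

variable {ι : Type*} [Fintype ι] [DecidableEq ι]

/-- Jacobi's formula for `X - M`, whose entrywise derivative is the identity; the norms absorb the
sign of `adj (-M)`. -/
theorem derivative_charpoly_eval_zero (M : Matrix ι ι ℂ) :
    ‖(Polynomial.derivative M.charpoly).eval 0‖ = ‖M.adjugate.trace‖ := by
  have h1 := derivation_det (R := ℂ) Polynomial.derivative' M.charmatrix
  have h2 : M.charmatrix.map (Polynomial.derivative' (R := ℂ)) = 1 := by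
    ext i j
    by_cases hij : i = j
    · subst hij
      simp [Polynomial.derivative']
    · simp [hij, Polynomial.derivative', one_apply]
  have h3 : M.charmatrix.map (Polynomial.evalRingHom 0) = -M := by
    ext i j
    by_cases hij : i = j <;> simp [hij]
  have h4 : Polynomial.derivative M.charpoly = M.charmatrix.adjugate.trace := by
    rw [h2, mul_one] at h1
    exact h1
  have h5 : (Polynomial.evalRingHom 0) M.charmatrix.adjugate.trace = (-M).adjugate.trace := by
    rw [← h3, ← RingHom.mapMatrix_apply, ← RingHom.map_adjugate]
    simp [trace]
  rw [h4]
  have h6 : -M = (-1 : ℂ) • M := by simp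
  have h7 : ‖(-M).adjugate.trace‖ = ‖M.adjugate.trace‖ := by
    rw [h6, adjugate_smul, trace_smul, norm_smul]
    simp
  rw [← h7, ← h5]
  rfl

theorem charpoly_conjTranspose_mul_self {m : ℕ} (A : Matrix (Fin m) (Fin m) ℂ) :
    (Aᴴ * A).charpoly =
      ∏ j : Fin m, (Polynomial.X - Polynomial.C ((singVal A j ^ 2 : ℝ) : ℂ)) := by
  have hn : Module.finrank ℂ (EuclideanSpace ℂ (Fin m)) = m := by simp
  have h := (toEuclideanLin A).isSymmetric_adjoint_comp_self.charpoly_eq hn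
  have h2 : (LinearMap.adjoint (toEuclideanLin A) ∘ₗ toEuclideanLin A).charpoly =
      (Aᴴ * A).charpoly := by
    rw [← toEuclideanLin_conjTranspose_eq_adjoint]
    change (toLpLin 2 2 Aᴴ ∘ₗ toLpLin 2 2 A).charpoly = _
    rw [toLpLin_eq_toLin, ← Matrix.toLin_mul, Matrix.charpoly_toLin]
  rw [← h2, h]
  refine Finset.prod_congr rfl fun j _ => ?_
  rw [singVal, LinearMap.sq_singularValues_fin _ hn]
  rfl

theorem finrank_range_toEuclideanLin {m : ℕ} {A : Matrix (Fin m) (Fin m) ℂ} {v : Fin m → ℂ}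
    (hv0 : v ≠ 0) (hv : A *ᵥ v = 0) (hker : ∀ w, A *ᵥ w = 0 → ∃ c : ℂ, w = c • v) :
    Module.finrank ℂ (LinearMap.range (toEuclideanLin A)) = m - 1 := by
  have h1 := (toEuclideanLin A).finrank_range_add_finrank_ker
  have h2 : LinearMap.ker (toEuclideanLin A) = ℂ ∙ (WithLp.toLp 2 v) := by
    ext w
    rw [LinearMap.mem_ker, Submodule.mem_span_singleton, toLpLin_apply]
    constructor
    · intro h
      obtain ⟨c, hc⟩ := hker w.ofLp (by simpa using h)
      exact ⟨c, by ext k; simp [hc]⟩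
    · rintro ⟨c, rfl⟩
      simp [mulVec_smul, hv]
  rw [h2, finrank_span_singleton (by simpa using hv0)] at h1
  simp at h1
  omega

/-- For a matrix with one-dimensional kernel, the product of the nonzero singular values is the
coefficient of the adjugate with respect to unit left and right null vectors. -/
theorem singVal_of_adjugate_ne_zero {m : ℕ} {A : Matrix (Fin m) (Fin m) ℂ}
    {u v : Fin m → ℂ} {c : ℂ}
    (hu1 : vecNorm u = 1) (hv1 : vecNorm v = 1) (hv : A *ᵥ v = 0)
    (hA : A.adjugate ≠ 0) (hc : A.adjugate = c • vecMulVec v u) :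
    (∀ j < m - 1, 0 < singVal A j) ∧ singVal A (m - 1) = 0 ∧
      ∏ j ∈ Finset.range (m - 1), singVal A j = ‖c‖ := by
  have hr := finrank_range_toEuclideanLin (ne_zero_of_vecNorm hv1) hv
    fun w hw => eq_smul_of_adjugate_ne_zero hA (ne_zero_of_vecNorm hv1) hv hw
  have hpos : ∀ j < m - 1, 0 < singVal A j := fun j hj => by
    rwa [singVal, LinearMap.singularValues_pos_iff_lt_finrank_range, hr]
  have hzero : singVal A (m - 1) = 0 := by
    rw [singVal, LinearMap.singularValues_eq_zero_iff_le_finrank_range, hr]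
  refine ⟨hpos, hzero, ?_⟩
  obtain ⟨l, rfl⟩ : ∃ l, m = l + 1 := by
    rcases m with _ | l
    · exact absurd (Subsingleton.elim u 0) (ne_zero_of_vecNorm hu1)
    · exact ⟨l, rfl⟩
  have h1 : ‖(Aᴴ * A).adjugate.trace‖ = ‖c‖ ^ 2 := by
    have : (Aᴴ * A).adjugate = (c * star c) • vecMulVec v (star v) := by
      rw [adjugate_mul_distrib, ← adjugate_conjTranspose, hc, conjTranspose_smul,
        conjTranspose_vecMulVec, smul_mul_smul_comm, vecMulVec_mul_vecMulVec,
        dotProduct_star_self hu1]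
      simp
    rw [this, trace_smul, trace_vecMulVec, dotProduct_star_self hv1]
    simp [sq]
  -- The last factor of the characteristic polynomial is `X`, as the last singular value is zero;
  -- the derivative at `0` is therefore, up to sign, the product of the other squares.
  rw [← derivative_charpoly_eval_zero, charpoly_conjTranspose_mul_self,
    Fin.prod_univ_castSucc] at h1
  simp only [Nat.add_sub_cancel] at hpos hzero ⊢
  simp only [Fin.val_last, hzero, Fin.val_castSucc] at h1
  simp [Polynomial.derivative_mul, Polynomial.eval_prod] at h1
  rw [Finset.prod_pow, Fin.prod_univ_eq_prod_range (fun j => singVal A j)] at h1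
  exact (sq_eq_sq₀ (Finset.prod_nonneg fun j hj => (hpos j (Finset.mem_range.1 hj)).le)
    (norm_nonneg c)).1 h1

end SingularValues

/-! ### The condition number of a simple eigenvalue of a pencil -/

section Conditioning

variable {ι : Type*} [Fintype ι] [DecidableEq ι] {A B : Matrix ι ι ℂ} {lam : ℂ} {y z : ι → ℂ}

/-- Pairing the perturbed equation with `y` removes `A - lam B` and leaves `δ yᵀ B q = yᵀ (ΔA - (lam
+ δ) ΔB) q` for the perturbed eigenvector `q`. All higher-order terms are kept as explicit functions
of `r`. -/
theorem norm_mul_le_of_mem_eigChanges (hy1 : vecNorm y = 1) (hz1 : vecNorm z = 1)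
    (hy : y ᵥ* (A - lam • B) = 0)
    (hker : ∀ w, (A - lam • B) *ᵥ w = 0 → ∃ c : ℂ, w = c • z)
    {r ε : ℝ} (hε : 0 < ε) {δ : ℂ} (hδ : δ ∈ eigChanges A B lam r ε) :
    ‖δ‖ * (‖y ⬝ᵥ B *ᵥ z‖ - specNorm B * r) ≤ ε * ((1 + ‖lam‖ + r) * (1 + r)) := by
  obtain ⟨ΔA, ΔB, x, Δx, hA, hB, hx1, ⟨-, hx⟩, hΔx, hδr, -, h⟩ := hδ
  obtain ⟨c, rfl⟩ := hker x hx
  have hc : ‖c‖ = 1 := by rwa [vecNorm_smul, hz1, mul_one] at hx1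
  set q := c • z + Δx with hq
  have hqn : vecNorm q ≤ 1 + r := (vecNorm_add_le _ _).trans (by rw [hx1]; gcongr)
  have hsplit : A + ΔA - (lam + δ) • (B + ΔB) =
      (A - lam • B) - δ • B + (ΔA - (lam + δ) • ΔB) := by
    ext i j
    simp
    ring
  have key : δ * (y ⬝ᵥ B *ᵥ q) = y ⬝ᵥ (ΔA - (lam + δ) • ΔB) *ᵥ q := by
    have h0 := congrArg (fun t => y ⬝ᵥ t) h
    simp only [hsplit, add_mulVec, sub_mulVec (A - lam • B), dotProduct_add, dotProduct_sub,
      dotProduct_zero] at h0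
    rw [dotProduct_mulVec y (A - lam • B), hy, zero_dotProduct, smul_mulVec, dotProduct_smul,
      smul_eq_mul] at h0
    linear_combination -h0
  have hr : 0 ≤ r := (norm_nonneg δ).trans hδr
  have hlow : ‖y ⬝ᵥ B *ᵥ z‖ - specNorm B * r ≤ ‖y ⬝ᵥ B *ᵥ q‖ := by
    have h1 : y ⬝ᵥ B *ᵥ q = c * (y ⬝ᵥ B *ᵥ z) + y ⬝ᵥ B *ᵥ Δx := by
      rw [hq, mulVec_add, dotProduct_add, mulVec_smul, dotProduct_smul, smul_eq_mul]
    have h2 : ‖y ⬝ᵥ B *ᵥ Δx‖ ≤ specNorm B * r := by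
      refine (norm_dotProduct_le _ _).trans ?_
      rw [hy1, one_mul]
      exact (vecNorm_mulVec_le _ _).trans
        (mul_le_mul_of_nonneg_left hΔx (specNorm_nonneg B))
    have h3 := norm_sub_le_norm_add (c * (y ⬝ᵥ B *ᵥ z)) (y ⬝ᵥ B *ᵥ Δx)
    rw [norm_mul, hc, one_mul, ← h1] at h3
    linarith
  have hup : ‖y ⬝ᵥ (ΔA - (lam + δ) • ΔB) *ᵥ q‖ ≤ ε * ((1 + ‖lam‖ + r) * (1 + r)) := by
    have h1 : ∀ M : Matrix ι ι ℂ, specNorm M ≤ ε → ‖y ⬝ᵥ M *ᵥ q‖ ≤ ε * (1 + r) := by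
      intro M hM
      refine (norm_dotProduct_le _ _).trans ?_
      rw [hy1, one_mul]
      exact (vecNorm_mulVec_le _ _).trans (mul_le_mul hM hqn (vecNorm_nonneg _) hε.le)
    rw [sub_mulVec, dotProduct_sub, smul_mulVec, dotProduct_smul, smul_eq_mul]
    refine (norm_sub_le _ _).trans ?_
    rw [norm_mul]
    have h2 : ‖lam + δ‖ ≤ ‖lam‖ + r := (norm_add_le _ _).trans (by gcongr)
    calc _ ≤ ε * (1 + r) + (‖lam‖ + r) * (ε * (1 + r)) :=
          add_le_add (h1 _ hA) (mul_le_mul h2 (h1 _ hB) (norm_nonneg _) (by positivity))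
      _ = _ := by ring
  calc _ ≤ ‖δ‖ * ‖y ⬝ᵥ B *ᵥ q‖ := mul_le_mul_of_nonneg_left hlow (norm_nonneg _)
    _ = ‖y ⬝ᵥ (ΔA - (lam + δ) • ΔB) *ᵥ q‖ := by rw [← norm_mul, key]
    _ ≤ _ := hup

theorem eigCond_le (hy1 : vecNorm y = 1) (hz1 : vecNorm z = 1)
    (hy : y ᵥ* (A - lam • B) = 0)
    (hker : ∀ w, (A - lam • B) *ᵥ w = 0 → ∃ c : ℂ, w = c • z)
    (hβ : y ⬝ᵥ B *ᵥ z ≠ 0) :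
    eigCond A B lam ≤ ENNReal.ofReal (‖y ⬝ᵥ B *ᵥ z‖⁻¹ * (1 + ‖lam‖)) := by
  set β := ‖y ⬝ᵥ B *ᵥ z‖
  have hβ0 : 0 < β := norm_pos_iff.2 hβ
  -- `g r` bounds `|δ| / ε` uniformly in `ε`, and tends to the claimed value as `r → 0⁺`.
  set g : ℝ → ℝ := fun r => (1 + ‖lam‖ + r) * (1 + r) / (β - specNorm B * r) with hg
  have hcont : ContinuousAt g 0 := by
    have : ContinuousAt (fun r : ℝ => β - specNorm B * r) 0 := by fun_prop
    exact ContinuousAt.div (by fun_prop) this (by simpa using hβ0.ne')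
  have hlim : Filter.Tendsto (fun r => ENNReal.ofReal (g r)) (𝓝[>] 0)
      (𝓝 (ENNReal.ofReal (β⁻¹ * (1 + ‖lam‖)))) := by
    have h0 : g 0 = β⁻¹ * (1 + ‖lam‖) := by simp [hg]; ring
    rw [← h0]
    exact (ENNReal.continuous_ofReal.tendsto _).comp (hcont.tendsto.mono_left nhdsWithin_le_nhds)
  refine ge_of_tendsto hlim ?_
  have hsmall : ∀ᶠ r : ℝ in 𝓝[>] 0, 0 < β - specNorm B * r := by
    have : Filter.Tendsto (fun r : ℝ => β - specNorm B * r) (𝓝[>] 0) (𝓝 (β - specNorm B * 0)) :=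
      (Continuous.tendsto (by fun_prop) _).mono_left nhdsWithin_le_nhds
    exact this.eventually (lt_mem_nhds (by simpa using hβ0))
  filter_upwards [hsmall, self_mem_nhdsWithin] with r hr hr0
  refine (iInf₂_le r hr0).trans ?_
  refine Filter.limsup_le_of_le (by isBoundedDefault) ?_
  filter_upwards [self_mem_nhdsWithin] with ε hε
  refine iSup₂_le fun δ hδ => ENNReal.ofReal_le_ofReal ?_
  have h := norm_mul_le_of_mem_eigChanges hy1 hz1 hy hker hε hδ
  rw [div_le_div_iff₀ hε hr]
  linarith

/-- The choice of `w` cancels the first-order residual of `q = z + t w` except along `star y`: `(A -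
(lam + t) B) q = -f`, where `f` has norm `t |β|` to first order. It remains to correct this residual
by small perturbations. -/
theorem mem_eigChanges {w : ι → ℂ} (hy1 : vecNorm y = 1) (hz1 : vecNorm z = 1)
    (hz : (A - lam • B) *ᵥ z = 0)
    (hw : (A - lam • B) *ᵥ w = B *ᵥ z - (y ⬝ᵥ B *ᵥ z) • star y)
    {t r ε : ℝ} (ht : 0 < t) (htr : t ≤ r) (hwr : t * vecNorm w ≤ r) (hw1 : t * vecNorm w < 1)
    (hε : t * (‖y ⬝ᵥ B *ᵥ z‖ + t * vecNorm (B *ᵥ w)) ≤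
      ε * ((1 - t * vecNorm w) * (1 + ‖lam + t‖))) :
    (t : ℂ) ∈ eigChanges A B lam r ε := by
  set β := y ⬝ᵥ B *ᵥ z
  set q := z + (t : ℂ) • w with hq
  set f : ι → ℂ := (t : ℂ) • (β • star y + (t : ℂ) • B *ᵥ w) with hf
  set μ := lam + (t : ℂ) with hμ
  have htn : ‖(t : ℂ)‖ = t := by simp [ht.le]
  have hqn : 1 - t * vecNorm w ≤ vecNorm q := by
    have := vecNorm_sub_le_add z ((t : ℂ) • w)
    rwa [vecNorm_smul, htn, hz1] at this
  have hqpos : 0 < vecNorm q := lt_of_lt_of_le (by linarith) hqn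
  have hq0 : q ≠ 0 := by
    intro h
    rw [h] at hqpos
    simp [vecNorm] at hqpos
  -- The rank-one matrix `f qᴴ / ‖q‖²` sends `q` to `f` and has norm at most `‖f‖ / ‖q‖`.
  set E : Matrix ι ι ℂ := ((vecNorm q ^ 2 : ℝ) : ℂ)⁻¹ • vecMulVec f (star q) with hE
  have hEq : E *ᵥ q = f := by
    rw [hE, smul_mulVec, vecMulVec_mulVec, ← vecNorm_sq, op_smul_eq_smul, smul_smul,
      inv_mul_cancel₀, one_smul]
    exact_mod_cast (pow_pos hqpos 2).ne'
  have hfn : vecNorm f ≤ t * (‖β‖ + t * vecNorm (B *ᵥ w)) := by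
    rw [hf, vecNorm_smul, htn]
    refine mul_le_mul_of_nonneg_left ((vecNorm_add_le _ _).trans_eq ?_) ht.le
    rw [vecNorm_smul, vecNorm_smul, vecNorm_star, hy1, mul_one, htn]
  have hEn : specNorm E ≤ ε * (1 + ‖μ‖) := by
    have h1 : specNorm E ≤ (vecNorm q ^ 2)⁻¹ * (vecNorm f * vecNorm q) := by
      rw [hE, specNorm_smul]
      have : ‖((vecNorm q ^ 2 : ℝ) : ℂ)⁻¹‖ = (vecNorm q ^ 2)⁻¹ := by
        rw [norm_inv, Complex.norm_real, Real.norm_of_nonneg (by positivity)]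
      rw [this]
      refine mul_le_mul_of_nonneg_left ?_ (by positivity)
      simpa [vecNorm_star] using specNorm_vecMulVec_le f (star q)
    have h2 : (vecNorm q ^ 2)⁻¹ * (vecNorm f * vecNorm q) = vecNorm f / vecNorm q := by
      field_simp
    rw [h2] at h1
    refine h1.trans ?_
    rw [div_le_iff₀ hqpos]
    have hε0 : 0 ≤ ε := by
      by_contra! hneg
      have : 0 < (1 - t * vecNorm w) * (1 + ‖μ‖) :=
        mul_pos (by linarith) (by positivity)
      have h3 : 0 ≤ t * (‖β‖ + t * vecNorm (B *ᵥ w)) :=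
        mul_nonneg ht.le (add_nonneg (norm_nonneg _) (mul_nonneg ht.le (vecNorm_nonneg _)))
      have := mul_neg_of_neg_of_pos hneg this
      linarith
    calc vecNorm f ≤ ε * ((1 - t * vecNorm w) * (1 + ‖μ‖)) := hfn.trans hε
      _ ≤ ε * (vecNorm q * (1 + ‖μ‖)) := by gcongr
      _ = _ := by ring
  -- The phase `φ` aligns the contributions: `ΔA = κ E` and `ΔB = -φ κ E` with `κ = 1 / (1 + |μ|)`
  -- give `ΔA - μ ΔB = E`. For `μ = 0` division by zero gives `φ = 0`, which still works.
  set φ : ℂ := star μ / ‖μ‖ with hφ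
  have hφμ : φ * μ = ‖μ‖ := by
    by_cases h : μ = 0
    · simp [h]
    · have : (‖μ‖ : ℂ) ≠ 0 := by exact_mod_cast norm_ne_zero_iff.2 h
      rw [hφ, div_mul_eq_mul_div, div_eq_iff this]
      simp [Complex.conj_mul', sq]
  have hφn : ‖φ‖ ≤ 1 := by
    rw [hφ, norm_div, norm_star]
    simpa using div_self_le_one ‖μ‖
  have hpos : 0 < 1 + ‖μ‖ := by positivity
  have hκ : ‖((1 + ‖μ‖ : ℝ) : ℂ)⁻¹‖ = (1 + ‖μ‖)⁻¹ := by
    rw [norm_inv, Complex.norm_real, Real.norm_of_nonneg hpos.le]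
  set κ : ℂ := ((1 + ‖μ‖ : ℝ) : ℂ)⁻¹ with hκdef
  have hκE : specNorm (κ • E) ≤ ε := by
    rw [specNorm_smul, hκ, inv_mul_le_iff₀ hpos]
    linarith
  refine ⟨κ • E, (-φ) • κ • E, z, (t : ℂ) • w, hκE, ?_, hz1,
    ⟨ne_zero_of_vecNorm hz1, hz⟩, ?_, ?_, hq0, ?_⟩
  · rw [specNorm_smul, norm_neg]
    exact (mul_le_of_le_one_left (specNorm_nonneg _) hφn).trans hκE
  · rwa [vecNorm_smul, htn]
  · rwa [htn]
  · have hsplit : A + κ • E - (lam + (t : ℂ)) • (B + (-φ) • κ • E) =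
        (A - lam • B) - (t : ℂ) • B + E := by
      have hκ1 : κ * (1 + μ * φ) = 1 := by
        rw [mul_comm μ, hφμ, hκdef]
        push_cast
        refine inv_mul_cancel₀ ?_
        exact_mod_cast hpos.ne'
      ext i j
      simp only [Matrix.add_apply, Matrix.sub_apply, Matrix.smul_apply, smul_eq_mul]
      linear_combination (E i j) * hκ1
    rw [hsplit, add_mulVec, hEq, sub_mulVec, mulVec_add, hz, mulVec_smul, hw, smul_mulVec,
      mulVec_add, mulVec_smul, hf]
    ext i
    simp
    ring

/-- For each positive `c` below the target, the real change `δ = c ε` is attainable for all small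
`ε`; then `c` increases to the target. -/
theorem le_eigCond (hy1 : vecNorm y = 1) (hz1 : vecNorm z = 1)
    (hy : y ᵥ* (A - lam • B) = 0) (hz : (A - lam • B) *ᵥ z = 0)
    (hker : ∀ w, (A - lam • B) *ᵥ w = 0 → ∃ c : ℂ, w = c • z)
    (hβ : y ⬝ᵥ B *ᵥ z ≠ 0) :
    ENNReal.ofReal (‖y ⬝ᵥ B *ᵥ z‖⁻¹ * (1 + ‖lam‖)) ≤ eigCond A B lam := by
  obtain ⟨w, hw⟩ := exists_mulVec_eq_of_dotProduct_eq_zero (u := y) (a := star y) (b := star z)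
    (by rw [dotProduct_star_self hy1]; exact one_ne_zero)
    (by rw [star_dotProduct_self hz1]; exact one_ne_zero) hy hker
    (r := B *ᵥ z - (y ⬝ᵥ B *ᵥ z) • star y)
    (by rw [dotProduct_sub, dotProduct_smul, dotProduct_star_self hy1]; simp)
  have hβ0 : 0 < ‖y ⬝ᵥ B *ᵥ z‖ := norm_pos_iff.2 hβ
  set T := ‖y ⬝ᵥ B *ᵥ z‖⁻¹ * (1 + ‖lam‖) with hT
  have hT0 : 0 < T := by positivity
  refine le_iInf₂ fun r hr => ?_
  refine le_of_tendsto (f := fun c : ℝ => ENNReal.ofReal c) (x := 𝓝[<] T)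
    ((ENNReal.continuous_ofReal.tendsto _).mono_left nhdsWithin_le_nhds) ?_
  filter_upwards [self_mem_nhdsWithin, mem_nhdsWithin_of_mem_nhds (lt_mem_nhds hT0)] with c hcT hc
  refine Filter.le_limsup_of_frequently_le (Filter.Eventually.frequently ?_) (by isBoundedDefault)
  have hev : ∀ {g h : ℝ → ℝ}, Continuous g → Continuous h → g 0 < h 0 →
      ∀ᶠ ε in 𝓝[>] (0 : ℝ), g ε < h ε := fun hg hh h0 =>
    nhdsWithin_le_nhds (hg.continuousAt.eventually_lt hh.continuousAt h0)
  have e1 := hev (g := fun ε => c * ε) (h := fun _ => r) (by fun_prop) (by fun_prop) (by simpa)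
  have e2 := hev (g := fun ε => c * ε * vecNorm w) (h := fun _ => r) (by fun_prop) (by fun_prop)
    (by simpa)
  have e3 := hev (g := fun ε => c * ε * vecNorm w) (h := fun _ => 1) (by fun_prop) (by fun_prop)
    (by simp)
  -- At `ε = 0` this reads `c |yᵀ B z| < 1 + |lam|`, which is `c < T`.
  have e4 := hev (g := fun ε => c * (‖y ⬝ᵥ B *ᵥ z‖ + c * ε * vecNorm (B *ᵥ w)))
    (h := fun ε => (1 - c * ε * vecNorm w) * (1 + ‖lam + ((c * ε : ℝ) : ℂ)‖))
    (by fun_prop) (by fun_prop) (by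
      simp only [mul_zero, zero_mul, add_zero, sub_zero, Complex.ofReal_zero, one_mul]
      have : c < T := hcT
      rw [hT, inv_mul_eq_div, lt_div_iff₀ hβ0] at this
      exact this)
  filter_upwards [e1, e2, e3, e4, self_mem_nhdsWithin] with ε h1 h2 h3 h4 hε
  have hε0 : 0 < ε := hε
  have hmem : ((c * ε : ℝ) : ℂ) ∈ eigChanges A B lam r ε := by
    refine mem_eigChanges hy1 hz1 hz hw (mul_pos hc hε0) h1.le h2.le h3 ?_
    have := mul_le_mul_of_nonneg_left h4.le hε0.le
    linarith
  refine le_trans ?_ (le_iSup₂ (f := fun δ (_ : δ ∈ eigChanges A B lam r ε) =>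
    ENNReal.ofReal (‖δ‖ / ε)) _ hmem)
  refine ENNReal.ofReal_le_ofReal (le_of_eq ?_)
  rw [Complex.norm_real, Real.norm_of_nonneg (mul_pos hc hε0).le, mul_div_cancel_right₀ _ hε0.ne']

theorem pencilPoly_eval (t : ℂ) : (pencilPoly A B).eval t = (A - t • B).det := by
  rw [pencilPoly, ← Polynomial.coe_evalRingHom, RingHom.map_det]
  congr 1
  ext i j
  simpa using mul_comm _ _

theorem derivative_pencilPoly_eval (t : ℂ) :
    (Polynomial.derivative (pencilPoly A B)).eval t = -((A - t • B).adjugate * B).trace := by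
  have h := derivation_det (R := ℂ) Polynomial.derivative'
    (A.map Polynomial.C - (Polynomial.X : Polynomial ℂ) • B.map Polynomial.C)
  have h1 : (A.map Polynomial.C - (Polynomial.X : Polynomial ℂ) • B.map Polynomial.C).map
      (Polynomial.derivative' (R := ℂ)) = -B.map Polynomial.C := by
    ext i j
    simp [Polynomial.derivative']
  have h2 : Polynomial.derivative (pencilPoly A B) =
      ((A.map Polynomial.C - (Polynomial.X : Polynomial ℂ) • B.map Polynomial.C).adjugate *
        -B.map Polynomial.C).trace := by
    rw [h1] at h
    exact h
  have h3 : (A.map Polynomial.C - (Polynomial.X : Polynomial ℂ) • B.map Polynomial.C).map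
      (Polynomial.evalRingHom t) = A - t • B := by
    ext i j
    simpa using mul_comm _ _
  have h4 : (B.map Polynomial.C).map (Polynomial.evalRingHom t) = B := by
    ext i j
    simp
  rw [h2, mul_neg, trace_neg, Polynomial.eval_neg, ← Polynomial.coe_evalRingHom,
    map_trace_adjugate_mul, h3, h4]

theorem isSimpleEigenvalue_iff : IsSimpleEigenvalue A B lam ↔
    (A - lam • B).det = 0 ∧ ((A - lam • B).adjugate * B).trace ≠ 0 := by
  rw [← pencilPoly_eval, ← neg_ne_zero, ← derivative_pencilPoly_eval, IsSimpleEigenvalue]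
  set P := pencilPoly A B
  -- For the zero polynomial the multiplicity is `0` and the derivative vanishes, so both sides
  -- fail.
  by_cases hP : P = 0
  · simp [hP]
  constructor
  · intro h
    have hroot : P.IsRoot lam := (Polynomial.rootMultiplicity_pos hP).1 (by omega)
    refine ⟨hroot, fun hd => ?_⟩
    have := (Polynomial.one_lt_rootMultiplicity_iff_isRoot hP).2 ⟨hroot, hd⟩
    omega
  · rintro ⟨hr, hd⟩
    have h1 : 0 < P.rootMultiplicity lam := (Polynomial.rootMultiplicity_pos hP).2 hr
    have h2 : ¬ 1 < P.rootMultiplicity lam := fun h =>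
      hd ((Polynomial.one_lt_rootMultiplicity_iff_isRoot hP).1 h).2
    omega

theorem eigCond_of_isSimpleEigenvalue (hy1 : vecNorm y = 1) (hz1 : vecNorm z = 1)
    (hy : IsLeftEigenvector A B lam y) (hz : IsRightEigenvector A B lam z)
    (hβ : y ⬝ᵥ B *ᵥ z ≠ 0) (hs : IsSimpleEigenvalue A B lam) :
    eigCond A B lam = ENNReal.ofReal (‖y ⬝ᵥ B *ᵥ z‖⁻¹ * (1 + ‖lam‖)) := by
  have hadj : (A - lam • B).adjugate ≠ 0 := fun h =>
    (isSimpleEigenvalue_iff.1 hs).2 (by simp [h])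
  have hker : ∀ w, (A - lam • B) *ᵥ w = 0 → ∃ c : ℂ, w = c • z := fun w hw =>
    eq_smul_of_adjugate_ne_zero hadj hz.1 hz.2 hw
  exact le_antisymm (eigCond_le hy1 hz1 hy.2 hker hβ) (le_eigCond hy1 hz1 hy.2 hz.2 hker hβ)

/-- The derivative of the characteristic polynomial is `-tr (adj (A - lam B) * B) = -c yᵀ B z` with
`c ≠ 0`, so geometric simplicity and `yᵀ B z ≠ 0` give algebraic simplicity. -/
theorem isSimpleEigenvalue_of_ker
    (hy : IsLeftEigenvector A B lam y) (hz : IsRightEigenvector A B lam z)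
    (hβ : y ⬝ᵥ B *ᵥ z ≠ 0) (hker : ∀ w, (A - lam • B) *ᵥ w = 0 → ∃ c : ℂ, w = c • z) :
    IsSimpleEigenvalue A B lam := by
  have hadj := adjugate_ne_zero_of_ker hy.1 hz.1 hy.2 hker
  obtain ⟨c, hc0, hc⟩ := exists_adjugate_eq_smul hadj hy.1 hz.1 hy.2 hz.2
  refine isSimpleEigenvalue_iff.2 ⟨exists_mulVec_eq_zero_iff.1 ⟨z, hz.1, hz.2⟩, ?_⟩
  rw [hc, smul_mul_assoc, trace_smul, vecMulVec_mul, trace_vecMulVec, dotProduct_comm,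
    ← dotProduct_mulVec, smul_eq_mul]
  exact mul_ne_zero hc0 hβ

end Conditioning

/-! ### Kronecker products and operator determinants -/

section Kronecker

variable {d : ℕ} {n : Fin d → ℕ}

theorem kron_mulVec_kronVec (M : (k : Fin d) → Matrix (Fin (n k)) (Fin (n k)) ℂ)
    (v : (k : Fin d) → Fin (n k) → ℂ) :
    kron M *ᵥ kronVec v = kronVec fun k => M k *ᵥ v k := by
  ext a
  simp only [mulVec, dotProduct, kron, kronVec, of_apply, ← Finset.prod_mul_distrib,
    Finset.prod_univ_sum, Fintype.piFinset_univ]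

theorem kronVec_vecMul_kron (M : (k : Fin d) → Matrix (Fin (n k)) (Fin (n k)) ℂ)
    (u : (k : Fin d) → Fin (n k) → ℂ) :
    kronVec u ᵥ* kron M = kronVec fun k => u k ᵥ* M k := by
  ext a
  simp only [vecMul, dotProduct, kron, kronVec, of_apply, ← Finset.prod_mul_distrib,
    Finset.prod_univ_sum, Fintype.piFinset_univ]

theorem kronVec_dotProduct_kronVec (u v : (k : Fin d) → Fin (n k) → ℂ) :
    kronVec u ⬝ᵥ kronVec v = ∏ k, u k ⬝ᵥ v k := by
  simp only [dotProduct, kronVec, ← Finset.prod_mul_distrib,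
    Finset.prod_univ_sum, Fintype.piFinset_univ]

theorem kron_mul (M N : (k : Fin d) → Matrix (Fin (n k)) (Fin (n k)) ℂ) :
    kron M * kron N = kron (M * N) := by
  ext a b
  simp only [mul_apply, kron, of_apply, ← Finset.prod_mul_distrib, Pi.mul_apply,
    Finset.prod_univ_sum, Fintype.piFinset_univ]

theorem kron_one : kron (1 : (k : Fin d) → Matrix (Fin (n k)) (Fin (n k)) ℂ) = 1 := by
  ext a b
  simp only [kron, of_apply, Pi.one_apply, one_apply, Finset.prod_ite_zero, Finset.prod_const_one,
    Finset.mem_univ, true_implies, funext_iff]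

theorem kron_vecMulVec (v w : (k : Fin d) → Fin (n k) → ℂ) :
    kron (fun k => vecMulVec (v k) (w k)) = vecMulVec (kronVec v) (kronVec w) := by
  ext a b
  simp [kron, kronVec, vecMulVec_apply, Finset.prod_mul_distrib]

theorem kronVec_eq_zero {v : (k : Fin d) → Fin (n k) → ℂ} {k : Fin d} (hk : v k = 0) :
    kronVec v = 0 := by
  ext a
  exact Finset.prod_eq_zero (Finset.mem_univ k) (by simp [hk])

theorem vecNorm_kronVec {v : (k : Fin d) → Fin (n k) → ℂ} (hv : ∀ k, vecNorm (v k) = 1) :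
    vecNorm (kronVec v) = 1 := by
  have h : star (kronVec v) = kronVec fun k => star (v k) := by
    ext a
    simp [kronVec]
  have h1 : ((vecNorm (kronVec v) ^ 2 : ℝ) : ℂ) = 1 := by
    rw [vecNorm_sq, h, kronVec_dotProduct_kronVec]
    exact Finset.prod_eq_one fun k _ => star_dotProduct_self (hv k)
  have h2 : vecNorm (kronVec v) ^ 2 = 1 := by exact_mod_cast h1
  exact (pow_eq_one_iff_of_nonneg (vecNorm_nonneg _) two_ne_zero).1 h2

/-- Reduces column identities for operator determinants to those of scalar determinants, entry by
entry. -/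
theorem opDet_apply (M : (k : Fin d) → Fin d → Matrix (Fin (n k)) (Fin (n k)) ℂ)
    (a b : (k : Fin d) → Fin (n k)) :
    opDet M a b = (Matrix.of fun k j => M k j (a k) (b k)).det := by
  rw [← det_transpose, det_apply']
  simp [opDet, Matrix.sum_apply, kron]

theorem opDet_mulVec (M : (k : Fin d) → Fin d → Matrix (Fin (n k)) (Fin (n k)) ℂ)
    (v : (k : Fin d) → Fin (n k) → ℂ) :
    opDet M *ᵥ kronVec v = ∑ s : Equiv.Perm (Fin d),
      ((Equiv.Perm.sign s : ℤ) : ℂ) • kronVec fun k => M k (s k) *ᵥ v k := by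
  simp only [opDet, sum_mulVec, smul_mulVec, kron_mulVec_kronVec]

theorem vecMul_opDet (M : (k : Fin d) → Fin d → Matrix (Fin (n k)) (Fin (n k)) ℂ)
    (u : (k : Fin d) → Fin (n k) → ℂ) :
    kronVec u ᵥ* opDet M = ∑ s : Equiv.Perm (Fin d),
      ((Equiv.Perm.sign s : ℤ) : ℂ) • kronVec fun k => u k ᵥ* M k (s k) := by
  simp only [opDet, vecMul_sum, vecMul_smul, kronVec_vecMul_kron]

theorem kronVec_dotProduct_opDet_mulVec
    (V : (k : Fin d) → Fin d → Matrix (Fin (n k)) (Fin (n k)) ℂ)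
    (u v : (k : Fin d) → Fin (n k) → ℂ) :
    kronVec u ⬝ᵥ opDet V *ᵥ kronVec v = (matB₀ V u v).det := by
  rw [opDet_mulVec, dotProduct_sum, ← det_transpose, det_apply']
  simp only [dotProduct_smul, kronVec_dotProduct_kronVec, smul_eq_mul, matB₀, transpose_apply,
    of_apply]

/-- Linearity in column `i`: of the terms `-x j • V k j` only `j = i` survives, the others repeating
a column. -/
theorem opDetCol_sub_smul (V₀ : (k : Fin d) → Matrix (Fin (n k)) (Fin (n k)) ℂ)
    (V : (k : Fin d) → Fin d → Matrix (Fin (n k)) (Fin (n k)) ℂ) (x : Fin d → ℂ) (i : Fin d) :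
    opDetCol V₀ V i - x i • opDet V =
      opDet fun k => Function.update (V k) i (linEval (V₀ k) (V k) x) := by
  ext a b
  have hupd : ∀ A : (k : Fin d) → Matrix (Fin (n k)) (Fin (n k)) ℂ,
      (Matrix.of fun k j => Function.update (V k) i (A k) j (a k) (b k)) =
        (Matrix.of fun k j => V k j (a k) (b k)).updateCol i fun k => A k (a k) (b k) := by
    intro A
    ext k j
    by_cases hj : j = i
    · subst hj
      simp
    · simp [hj]
  rw [opDetCol, Matrix.sub_apply, Matrix.smul_apply, opDet_apply, opDet_apply, opDet_apply, hupd,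
    hupd]
  set m : Matrix (Fin d) (Fin d) ℂ := Matrix.of fun k j => V k j (a k) (b k) with hm
  have hcol : (fun k => linEval (V₀ k) (V k) x (a k) (b k)) =
      (fun k => V₀ k (a k) (b k)) + fun k => ∑ j, (-x j) • m k j := by
    ext k
    simp [linEval, hm, Matrix.sum_apply, sub_eq_add_neg]
  rw [hcol, det_updateCol_add, det_updateCol_sum]
  simp [sub_eq_add_neg]

theorem isRightEigenvector_kronVec {V₀ : (k : Fin d) → Matrix (Fin (n k)) (Fin (n k)) ℂ}
    {V : (k : Fin d) → Fin d → Matrix (Fin (n k)) (Fin (n k)) ℂ} {x : Fin d → ℂ}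
    {v : (k : Fin d) → Fin (n k) → ℂ} (hv : ∀ k, vecNorm (v k) = 1)
    (hvW : ∀ k, linEval (V₀ k) (V k) x *ᵥ v k = 0) (i : Fin d) :
    IsRightEigenvector (opDetCol V₀ V i) (opDet V) (x i) (kronVec v) := by
  refine ⟨ne_zero_of_vecNorm (vecNorm_kronVec hv), ?_⟩
  rw [opDetCol_sub_smul, opDet_mulVec]
  refine Finset.sum_eq_zero fun s _ => ?_
  -- In the term of `s`, column `i` is used by the factor `k = s⁻¹ i`, where `W_k` meets its null
  -- vector.
  rw [kronVec_eq_zero (k := s.symm i), smul_zero]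
  simp [hvW]

theorem isLeftEigenvector_kronVec {V₀ : (k : Fin d) → Matrix (Fin (n k)) (Fin (n k)) ℂ}
    {V : (k : Fin d) → Fin d → Matrix (Fin (n k)) (Fin (n k)) ℂ} {x : Fin d → ℂ}
    {u : (k : Fin d) → Fin (n k) → ℂ} (hu : ∀ k, vecNorm (u k) = 1)
    (huW : ∀ k, u k ᵥ* linEval (V₀ k) (V k) x = 0) (i : Fin d) :
    IsLeftEigenvector (opDetCol V₀ V i) (opDet V) (x i) (kronVec u) := by
  refine ⟨ne_zero_of_vecNorm (vecNorm_kronVec hu), ?_⟩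
  rw [opDetCol_sub_smul, vecMul_opDet]
  refine Finset.sum_eq_zero fun s _ => ?_
  rw [kronVec_eq_zero (k := s.symm i), smul_zero]
  simp [huW]

theorem kron_update_one_apply (k : Fin d) (A : Matrix (Fin (n k)) (Fin (n k)) ℂ)
    (a b : (k : Fin d) → Fin (n k)) :
    kron (Function.update 1 k A) a b = A (a k) (b k) *
      ∏ l ∈ Finset.univ.erase k, (1 : Matrix (Fin (n l)) (Fin (n l)) ℂ) (a l) (b l) := by
  rw [kron, of_apply, ← Finset.mul_prod_erase _ _ (Finset.mem_univ k)]
  congr 1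
  · simp
  · refine Finset.prod_congr rfl fun l hl => ?_
    rw [Function.update_of_ne (Finset.ne_of_mem_erase hl), Pi.one_apply]

/-- The matrix `1 ⊗ ⋯ ⊗ A ⊗ ⋯ ⊗ 1` with `A` in the `k`-th factor. -/
def slot (k : Fin d) : Matrix (Fin (n k)) (Fin (n k)) ℂ →ₗ[ℂ]
    Matrix ((k : Fin d) → Fin (n k)) ((k : Fin d) → Fin (n k)) ℂ where
  toFun A := kron (Function.update 1 k A)
  map_add' A B := by
    ext a b
    simp [kron_update_one_apply, add_mul]
  map_smul' c A := by
    ext a b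
    simp [kron_update_one_apply, mul_assoc]

theorem slot_apply (k : Fin d) (A : Matrix (Fin (n k)) (Fin (n k)) ℂ) :
    slot k A = kron (Function.update 1 k A) := rfl

theorem slot_mul (k : Fin d) (A B : Matrix (Fin (n k)) (Fin (n k)) ℂ) :
    slot k A * slot k B = slot k (A * B) := by
  rw [slot_apply, slot_apply, slot_apply, kron_mul, ← Function.update_mul, one_mul]

theorem slot_one (k : Fin d) : slot k (1 : Matrix (Fin (n k)) (Fin (n k)) ℂ) = 1 := by
  rw [slot_apply, Function.update_one, kron_one]

theorem slot_commute {k l : Fin d} (hkl : k ≠ l) (A : Matrix (Fin (n k)) (Fin (n k)) ℂ)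
    (B : Matrix (Fin (n l)) (Fin (n l)) ℂ) : slot k A * slot l B = slot l B * slot k A := by
  rw [slot_apply, slot_apply, kron_mul, kron_mul]
  congr 1
  ext1 m
  by_cases hk : m = k
  · subst hk
    simp [hkl]
  · simp [hk]

theorem kron_eq_mul_slot (M : (k : Fin d) → Matrix (Fin (n k)) (Fin (n k)) ℂ) (k : Fin d) :
    kron M = kron (Function.update M k 1) * slot k (M k) := by
  rw [slot_apply, kron_mul]
  congr 1
  ext1 m
  by_cases hk : m = k
  · subst hk
    simp
  · simp [hk]

theorem kron_mulVec_eq_self {P : (k : Fin d) → Matrix (Fin (n k)) (Fin (n k)) ℂ}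
    {z : ((k : Fin d) → Fin (n k)) → ℂ} (h : ∀ k, slot k (P k) *ᵥ z = z) : kron P *ᵥ z = z := by
  have key : ∀ s : Finset (Fin d), kron (s.piecewise P 1) *ᵥ z = z := by
    intro s
    induction s using Finset.induction_on with
    | empty => rw [Finset.piecewise_empty, kron_one, one_mulVec]
    | insert a s ha ih =>
      have h1 : Function.update (s.piecewise P 1) a 1 = s.piecewise P 1 := by
        rw [Function.update_eq_self_iff]
        simp [ha]
      rw [Finset.piecewise_insert, kron_eq_mul_slot _ a, Function.update_idem,
        Function.update_self, ← mulVec_mulVec, h, h1, ih]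
  simpa using key Finset.univ

/-- A vector annihilated in each factor by a matrix with one-dimensional kernel is a multiple of
the Kronecker product of the null vectors. -/
theorem exists_eq_smul_kronVec {W : (k : Fin d) → Matrix (Fin (n k)) (Fin (n k)) ℂ}
    {u v : (k : Fin d) → Fin (n k) → ℂ} (hu : ∀ k, vecNorm (u k) = 1)
    (hv : ∀ k, vecNorm (v k) = 1) (huW : ∀ k, u k ᵥ* W k = 0) (hvW : ∀ k, W k *ᵥ v k = 0)
    (hW : ∀ k, (W k).adjugate ≠ 0) {z : ((k : Fin d) → Fin (n k)) → ℂ}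
    (hz : ∀ k, slot k (W k) *ᵥ z = 0) : ∃ c : ℂ, z = c • kronVec v := by
  have h : ∀ k, slot k (vecMulVec (v k) (star (v k))) *ᵥ z = z := by
    intro k
    -- From `C * W k = 1 - v_k v_kᴴ`, the projection `v_k v_kᴴ` in slot `k` fixes `z`. The product
    -- of these projections over all slots has rank one with range spanned by `kronVec v`.
    obtain ⟨C, hC⟩ := exists_mul_eq_one_sub_vecMulVec (u := u k) (a := star (u k))
      (b := star (v k)) (by rw [dotProduct_star_self (hu k)]; exact one_ne_zero)
      (star_dotProduct_self (hv k)) (huW k) (hvW k)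
      fun w hw => eq_smul_of_adjugate_ne_zero (hW k) (ne_zero_of_vecNorm (hv k)) (hvW k) hw
    have h1 : slot k (C * W k) *ᵥ z = 0 := by
      rw [← slot_mul, ← mulVec_mulVec, hz, mulVec_zero]
    rw [hC, map_sub, slot_one, sub_mulVec, one_mulVec, sub_eq_zero] at h1
    exact h1.symm
  have h2 := kron_mulVec_eq_self h
  rw [kron_vecMulVec, vecMulVec_mulVec, op_smul_eq_smul] at h2
  exact ⟨_, h2.symm⟩

end Kronecker

/-! ### Commutativity of the matrices `Δ₀⁻¹ Δ_j` and their joint eigenvectors -/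

section Commuting

variable {d : ℕ} {n : Fin d → ℕ} {V₀ : (k : Fin d) → Matrix (Fin (n k)) (Fin (n k)) ℂ}
  {V : (k : Fin d) → Fin d → Matrix (Fin (n k)) (Fin (n k)) ℂ}

theorem opDet_eq_zero_of_column_eq {M : (k : Fin d) → Fin d → Matrix (Fin (n k)) (Fin (n k)) ℂ}
    {i j : Fin d} (hij : i ≠ j) (h : ∀ k, M k i = M k j) : opDet M = 0 := by
  ext a b
  rw [opDet_apply, Matrix.zero_apply]
  exact det_zero_of_column_eq hij fun k => by simp [h k]

theorem opDet_swap (M : (k : Fin d) → Fin d → Matrix (Fin (n k)) (Fin (n k)) ℂ) {i j : Fin d}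
    (hij : i ≠ j) : opDet (fun k l => M k (Equiv.swap i j l)) = -opDet M := by
  ext a b
  rw [Matrix.neg_apply, opDet_apply, opDet_apply]
  have := det_permute' (Equiv.swap i j) (Matrix.of fun k l => M k l (a k) (b k))
  rw [Equiv.Perm.sign_swap hij] at this
  simpa [submatrix] using this

/-- The cofactor on the left of each slot does not involve `A`, so relations between slot matrices
can be applied on the right, term by term. -/
theorem opDet_update_eq_sum (A : (k : Fin d) → Matrix (Fin (n k)) (Fin (n k)) ℂ) (i : Fin d) :
    opDet (fun k => Function.update (V k) i (A k)) = ∑ s : Equiv.Perm (Fin d),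
      ((Equiv.Perm.sign s : ℤ) : ℂ) •
        (kron (Function.update (fun k => V k (s k)) (s.symm i) 1) *
          slot (s.symm i) (A (s.symm i))) := by
  refine Finset.sum_congr rfl fun s _ => ?_
  rw [kron_eq_mul_slot _ (s.symm i)]
  congr 3
  · ext1 k
    by_cases hk : k = s.symm i
    · subst hk
      simp
    · have : s k ≠ i := fun h => hk (by simp [← h])
      simp [hk, this]
  · simp

/-- Cramer's rule for operator determinants. -/
theorem opDet_mulVec_eq {f : ((k : Fin d) → Fin (n k)) → ℂ}
    {g : Fin d → ((k : Fin d) → Fin (n k)) → ℂ}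
    (h : ∀ k, ∑ j, slot k (V k j) *ᵥ g j = slot k (V₀ k) *ᵥ f) (i : Fin d) :
    opDet V *ᵥ g i = opDetCol V₀ V i *ᵥ f := by
  -- Substituting the system into column `i` expresses `Δ_i f` through the `g j`; for `j ≠ i` a
  -- column is repeated.
  have h1 : opDetCol V₀ V i *ᵥ f =
      ∑ j, opDet (fun k => Function.update (V k) i (V k j)) *ᵥ g j := by
    rw [opDetCol, opDet_update_eq_sum]
    simp only [opDet_update_eq_sum, sum_mulVec, smul_mulVec, ← mulVec_mulVec]
    rw [Finset.sum_comm]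
    refine Finset.sum_congr rfl fun s _ => ?_
    rw [← h, mulVec_sum, Finset.smul_sum]
  rw [h1, Finset.sum_eq_single i]
  · simp
  · intro j _ hj
    rw [opDet_eq_zero_of_column_eq (i := i) (j := j) hj.symm (fun k => by simp [hj]), zero_mulVec]
  · simp

/-- The matrix `Δ₀⁻¹ Δ_i`. -/
noncomputable def opDetQuot (V₀ : (k : Fin d) → Matrix (Fin (n k)) (Fin (n k)) ℂ)
    (V : (k : Fin d) → Fin d → Matrix (Fin (n k)) (Fin (n k)) ℂ) (i : Fin d) :
    Matrix ((k : Fin d) → Fin (n k)) ((k : Fin d) → Fin (n k)) ℂ :=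
  (opDet V)⁻¹ * opDetCol V₀ V i

theorem opDet_mul_opDetQuot (hV : (opDet V).det ≠ 0) (i : Fin d) :
    opDet V * opDetQuot V₀ V i = opDetCol V₀ V i := by
  rw [opDetQuot, mul_nonsing_inv_cancel_left _ _ (isUnit_iff_ne_zero.2 hV)]

theorem opDet_mulVec_injective (hV : (opDet V).det ≠ 0) :
    Function.Injective (opDet V).mulVec :=
  mulVec_injective_iff_isUnit.2 ((isUnit_iff_isUnit_det _).2 (isUnit_iff_ne_zero.2 hV))

/-- Cramer's rule with `f = 0` makes the block system injective, hence surjective in finite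
dimension. Solving it for each basis vector `f`, Cramer's rule identifies the solution as `Δ₀⁻¹ Δ_j
f`. -/
theorem sum_slot_mul_opDetQuot (hV : (opDet V).det ≠ 0) (k : Fin d) :
    ∑ j, slot k (V k j) * opDetQuot V₀ V j = slot k (V₀ k) := by
  let Φ : (Fin d → ((k : Fin d) → Fin (n k)) → ℂ) →ₗ[ℂ]
      (Fin d → ((k : Fin d) → Fin (n k)) → ℂ) :=
    LinearMap.pi fun k => ∑ j, (slot k (V k j)).mulVecLin ∘ₗ LinearMap.proj j
  have hΦ : ∀ g k, Φ g k = ∑ j, slot k (V k j) *ᵥ g j := fun g k => by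
    simp [Φ]
  have hinj : Function.Injective Φ := by
    refine (injective_iff_map_eq_zero Φ).2 fun g hg => ?_
    ext1 i
    refine opDet_mulVec_injective hV ?_
    rw [opDet_mulVec_eq (V₀ := V₀) (f := 0) (g := g) (fun k => ?_) i]
    · simp
    · rw [← hΦ, hg]
      simp
  have hsurj := LinearMap.injective_iff_surjective.1 hinj
  refine ext_of_mulVec_single fun b => ?_
  set f : ((k : Fin d) → Fin (n k)) → ℂ := Pi.single b 1
  obtain ⟨g, hg⟩ := hsurj fun k => slot k (V₀ k) *ᵥ f
  have hg' : ∀ k, ∑ j, slot k (V k j) *ᵥ g j = slot k (V₀ k) *ᵥ f := fun k => by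
    rw [← hΦ, hg]
  have hquot : ∀ j, opDetQuot V₀ V j *ᵥ f = g j := fun j => by
    refine opDet_mulVec_injective hV ?_
    rw [mulVec_mulVec, opDet_mul_opDetQuot hV, opDet_mulVec_eq hg']
  rw [sum_mulVec, ← hg']
  exact Finset.sum_congr rfl fun j _ => by rw [← mulVec_mulVec, hquot]

/-- Different slots commute, so `slot k (V₀ k) * slot l (V₀ l)` can be expanded in either order; the
difference of the expansions is the commutator sum. -/
theorem sum_slot_mul_slot_mul_commutator (hV : (opDet V).det ≠ 0) {k l : Fin d} (hkl : k ≠ l) :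
    ∑ q : Fin d × Fin d, slot k (V k q.1) * slot l (V l q.2) *
      (opDetQuot V₀ V q.1 * opDetQuot V₀ V q.2 -
        opDetQuot V₀ V q.2 * opDetQuot V₀ V q.1) = 0 := by
  have h1 : ∑ q : Fin d × Fin d, slot k (V k q.1) * slot l (V l q.2) *
      (opDetQuot V₀ V q.1 * opDetQuot V₀ V q.2) = slot k (V₀ k) * slot l (V₀ l) := by
    rw [Fintype.sum_prod_type_right, ← sum_slot_mul_opDetQuot hV l, Finset.mul_sum]
    refine Finset.sum_congr rfl fun m _ => ?_
    rw [← mul_assoc, slot_commute hkl, ← sum_slot_mul_opDetQuot hV k, Finset.mul_sum,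
      Finset.sum_mul]
    refine Finset.sum_congr rfl fun j _ => ?_
    rw [slot_commute hkl]
    simp only [mul_assoc]
  have h2 : ∑ q : Fin d × Fin d, slot k (V k q.1) * slot l (V l q.2) *
      (opDetQuot V₀ V q.2 * opDetQuot V₀ V q.1) = slot k (V₀ k) * slot l (V₀ l) := by
    rw [Fintype.sum_prod_type, slot_commute hkl, ← sum_slot_mul_opDetQuot hV k, Finset.mul_sum]
    refine Finset.sum_congr rfl fun j _ => ?_
    rw [← mul_assoc, ← slot_commute hkl, ← sum_slot_mul_opDetQuot hV l, Finset.mul_sum,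
      Finset.sum_mul]
    refine Finset.sum_congr rfl fun m _ => ?_
    simp only [mul_assoc]
  simp only [mul_sub, Finset.sum_sub_distrib, h1, h2, sub_self]

theorem opDet_update_update_eq_sum {p q : Fin d} (hpq : p ≠ q) (j m : Fin d) :
    opDet (fun k l => V k (Function.update (Function.update id p j) q m l)) =
      ∑ s : Equiv.Perm (Fin d), ((Equiv.Perm.sign s : ℤ) : ℂ) •
        (kron (Function.update (Function.update (fun k => V k (s k)) (s.symm q) 1)
          (s.symm p) 1) *
          (slot (s.symm p) (V (s.symm p) j) * slot (s.symm q) (V (s.symm q) m))) := by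
  refine Finset.sum_congr rfl fun s _ => ?_
  have hne : s.symm p ≠ s.symm q := fun h => hpq (s.symm.injective h)
  rw [kron_eq_mul_slot _ (s.symm q), kron_eq_mul_slot _ (s.symm p), mul_assoc]
  congr 3
  · ext1 k
    by_cases hk : k = s.symm p
    · subst hk
      simp
    by_cases hk' : k = s.symm q
    · subst hk'
      simp [hk]
    have h1 : s k ≠ p := fun h => hk (by simp [← h])
    have h2 : s k ≠ q := fun h => hk' (by simp [← h])
    simp [hk, hk', h1, h2]
  · simp [hne, hpq]
  · simp

theorem opDetQuot_commute (hV : (opDet V).det ≠ 0) (p q : Fin d) :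
    Commute (opDetQuot V₀ V p) (opDetQuot V₀ V q) := by
  by_cases hpq : p = q
  · subst hpq
    exact Commute.refl _
  set c : Fin d × Fin d → Matrix ((k : Fin d) → Fin (n k)) ((k : Fin d) → Fin (n k)) ℂ :=
    fun t => opDetQuot V₀ V t.1 * opDetQuot V₀ V t.2 - opDetQuot V₀ V t.2 * opDetQuot V₀ V t.1
    with hc
  -- Columns `p` and `q` are replaced by columns `t.1` and `t.2`. The sum vanishes term by term in
  -- `s`, by the commutator identity for slots `s⁻¹ p` and `s⁻¹ q`. Only `(p, q)` and `(q, p)` avoid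
  -- repeated columns, and together they contribute `2 Δ₀ c (p, q)`.
  have h1 : ∑ t : Fin d × Fin d,
      opDet (fun k l => V k (Function.update (Function.update id p t.1) q t.2 l)) * c t = 0 := by
    simp only [opDet_update_update_eq_sum hpq, Finset.sum_mul, smul_mul_assoc]
    rw [Finset.sum_comm]
    refine Finset.sum_eq_zero fun s _ => ?_
    have hne : s.symm p ≠ s.symm q := fun h => hpq (s.symm.injective h)
    rw [← Finset.smul_sum]
    simp only [mul_assoc]
    rw [← Finset.mul_sum]
    have := sum_slot_mul_slot_mul_commutator (V₀ := V₀) hV hne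
    simp only [mul_assoc] at this
    rw [this, mul_zero, smul_zero]
  have hne : (p, q) ≠ (q, p) := fun h => hpq (congrArg Prod.fst h)
  rw [Fintype.sum_eq_add (p, q) (q, p) hne] at h1
  · have e1 : (fun (k : Fin d) l => V k (Function.update (Function.update id p p) q q l)) = V := by
      ext1 k
      ext1 l
      have : Function.update (Function.update id p p) q q = (id : Fin d → Fin d) := by
        rw [Function.update_eq_iff]
        exact ⟨rfl, fun l hl => by by_cases h : l = p <;> simp [h]⟩
      rw [this, id]
    have e2 : (fun (k : Fin d) l => V k (Function.update (Function.update id p q) q p l)) =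
        fun k l => V k (Equiv.swap p q l) := by
      ext1 k
      ext1 l
      congr 1
      rw [Equiv.swap_apply_def]
      by_cases h1 : l = q
      · subst h1
        simp [Ne.symm hpq]
      · by_cases h2 : l = p
        · subst h2
          simp [hpq]
        · simp [h1, h2]
    have e3 : c (q, p) = -c (p, q) := by simp [hc]
    simp only [e1, e2] at h1
    rw [opDet_swap V hpq, e3, neg_mul_neg, ← two_mul] at h1
    have h2 : opDet V * c (p, q) = 0 := by
      have h3 : (2 : ℂ) • (opDet V * c (p, q)) = 0 := by
        rw [← h1, two_smul, two_mul]
      exact (smul_eq_zero.1 h3).resolve_left two_ne_zero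
    have h4 : c (p, q) = 0 := by
      rw [← nonsing_inv_mul_cancel_left (opDet V) (c (p, q)) (isUnit_iff_ne_zero.2 hV), h2,
        mul_zero]
    exact sub_eq_zero.1 h4
  · rintro ⟨j, m⟩ ⟨hn1, hn2⟩
    suffices opDet (fun k l => V k (Function.update (Function.update id p j) q m l)) = 0 by
      simp only [this, zero_mul]
    by_cases hjm : j = m
    · subst hjm
      exact opDet_eq_zero_of_column_eq hpq fun k => by simp [hpq]
    by_cases hj : j = p ∨ j = q
    · have hm : m ≠ p ∧ m ≠ q := by
        grind
      exact opDet_eq_zero_of_column_eq (i := q) (j := m) hm.2.symm fun k => by simp [hm.1, hm.2]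
    · push Not at hj
      exact opDet_eq_zero_of_column_eq (i := p) (j := j) hj.1.symm fun k => by
        simp [hj.1, hj.2, hpq]

/-- Operators are treated one at a time: `T` is cut down to an eigenspace of the next operator, and
commutativity keeps it invariant under all of them. -/
theorem exists_common_eigenvector {K E κ : Type*} [Field K] [IsAlgClosed K] [AddCommGroup E]
    [Module K E] [FiniteDimensional K E] [Finite κ] (f : κ → Module.End K E)
    (hf : ∀ i j, Commute (f i) (f j)) (S : Submodule K E) (hS : S ≠ ⊥)
    (hinv : ∀ i, ∀ z ∈ S, f i z ∈ S) :
    ∃ z ∈ S, z ≠ 0 ∧ ∃ μ : κ → K, ∀ i, f i z = μ i • z := by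
  classical
  have := Fintype.ofFinite κ
  have key : ∀ s : Finset κ, ∃ T ≤ S, T ≠ ⊥ ∧ (∀ i, ∀ z ∈ T, f i z ∈ T) ∧
      ∀ i ∈ s, ∃ μ : K, ∀ z ∈ T, f i z = μ • z := by
    intro s
    induction s using Finset.induction_on with
    | empty => exact ⟨S, le_rfl, hS, hinv, by simp⟩
    | insert a s ha ih =>
      obtain ⟨T, hTS, hT, hTinv, hμ⟩ := ih
      have hnt : Nontrivial T := (Submodule.nontrivial_iff_ne_bot).2 hT
      obtain ⟨μ, h⟩ := Module.End.exists_eigenvalue ((f a).restrict (hTinv a))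
      obtain ⟨w, hw⟩ := h.exists_hasEigenvector
      have hfw : f a w = μ • (w : E) := congrArg Subtype.val hw.apply_eq_smul
      refine ⟨T ⊓ (f a).eigenspace μ, inf_le_left.trans hTS, ?_, ?_, ?_⟩
      · refine (Submodule.ne_bot_iff _).2 ⟨w, ⟨w.2, ?_⟩, fun h0 => hw.2 (Subtype.ext h0)⟩
        exact Module.End.mem_eigenspace_iff.2 hfw
      · rintro i z ⟨hz, hz'⟩
        refine ⟨hTinv i z hz, ?_⟩
        have hz2 := Module.End.mem_eigenspace_iff.1 hz'
        refine Module.End.mem_eigenspace_iff.2 ?_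
        have := LinearMap.congr_fun (hf a i) z
        rw [Module.End.mul_apply, Module.End.mul_apply] at this
        rw [this, hz2, map_smul]
      · intro i hi
        rcases Finset.mem_insert.1 hi with rfl | hi
        · exact ⟨μ, fun z hz => Module.End.mem_eigenspace_iff.1 hz.2⟩
        · obtain ⟨ν, hν⟩ := hμ i hi
          exact ⟨ν, fun z hz => hν z hz.1⟩
  obtain ⟨T, hTS, hT, -, hμ⟩ := key Finset.univ
  obtain ⟨z, hz, hz0⟩ := (Submodule.ne_bot_iff _).1 hT
  choose μ hμ using fun i => hμ i (Finset.mem_univ i)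
  exact ⟨z, hTS hz, hz0, μ, fun i => hμ i z hz⟩

/-- With the next lemma, this makes every joint eigenvalue tuple of the `Δ₀⁻¹ Δ_j` a common zero of
the determinants `det W_k`. -/
theorem slot_linEval_mulVec_eq_zero (hV : (opDet V).det ≠ 0) {μ : Fin d → ℂ}
    {z : ((k : Fin d) → Fin (n k)) → ℂ} (hz : ∀ j, opDetQuot V₀ V j *ᵥ z = μ j • z) (k : Fin d) :
    slot k (linEval (V₀ k) (V k) μ) *ᵥ z = 0 := by
  rw [linEval, map_sub, sub_mulVec, ← sum_slot_mul_opDetQuot hV k, map_sum, sum_mulVec, sum_mulVec,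
    sub_eq_zero]
  refine Finset.sum_congr rfl fun j _ => ?_
  rw [← mulVec_mulVec, hz, map_smul, smul_mulVec, mulVec_smul]

theorem det_eq_zero_of_slot_mulVec {k : Fin d} {W : Matrix (Fin (n k)) (Fin (n k)) ℂ}
    {z : ((k : Fin d) → Fin (n k)) → ℂ} (hz0 : z ≠ 0) (hz : slot k W *ᵥ z = 0) : W.det = 0 := by
  by_contra h
  refine hz0 ?_
  rw [← one_mulVec z, ← slot_one k, ← nonsing_inv_mul W (isUnit_iff_ne_zero.2 h), ← slot_mul,
    ← mulVec_mulVec, hz, mulVec_zero]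

theorem ker_opDetCol_sub_smul {x : Fin d → ℂ} {u v : (k : Fin d) → Fin (n k) → ℂ}
    (hV : (opDet V).det ≠ 0)
    (hu : ∀ k, vecNorm (u k) = 1) (hv : ∀ k, vecNorm (v k) = 1)
    (huW : ∀ k, u k ᵥ* linEval (V₀ k) (V k) x = 0)
    (hvW : ∀ k, linEval (V₀ k) (V k) x *ᵥ v k = 0)
    (hadj : ∀ k, (linEval (V₀ k) (V k) x).adjugate ≠ 0) (hB : (matB₀ V u v).det ≠ 0) (i : Fin d)
    (huniq : ∀ x' : Fin d → ℂ, (∀ k, (linEval (V₀ k) (V k) x').det = 0) → x' i = x i → x' = x)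
    {w : ((k : Fin d) → Fin (n k)) → ℂ} (hw : (opDetCol V₀ V i - x i • opDet V) *ᵥ w = 0) :
    ∃ c : ℂ, w = c • kronVec v := by
  set y := kronVec u with hy
  have hβ : y ⬝ᵥ opDet V *ᵥ kronVec v ≠ 0 := by rwa [hy, kronVec_dotProduct_opDet_mulVec]
  have hleft : ∀ j, y ᵥ* opDetCol V₀ V j = x j • y ᵥ* opDet V := fun j => by
    have := (isLeftEigenvector_kronVec hu huW j).2
    rwa [vecMul_sub, vecMul_smul, sub_eq_zero] at this
  -- `S` is the part of the eigenspace annihilated by `yᵀ Δ₀`. It is invariant under every `Γ_j =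
  -- Δ₀⁻¹ Δ_j`, because these commute and `yᵀ Δ₀ Γ_j = x_j yᵀ Δ₀`.
  let S : Submodule ℂ (((k : Fin d) → Fin (n k)) → ℂ) :=
    LinearMap.ker ((opDetQuot V₀ V i).mulVecLin - x i • LinearMap.id) ⊓
      LinearMap.ker (dotProductBilin ℂ ℂ (y ᵥ* opDet V))
  have hS : ∀ z, z ∈ S ↔ opDetQuot V₀ V i *ᵥ z = x i • z ∧ y ⬝ᵥ opDet V *ᵥ z = 0 := fun z => by
    simp [S, sub_eq_zero, dotProduct_mulVec]
  have hquot : ∀ z, (opDetCol V₀ V i - x i • opDet V) *ᵥ z = 0 →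
      opDetQuot V₀ V i *ᵥ z = x i • z := by
    intro z hz
    refine opDet_mulVec_injective hV ?_
    rw [mulVec_mulVec, opDet_mul_opDetQuot hV, mulVec_smul, ← smul_mulVec, ← sub_eq_zero,
      ← sub_mulVec, hz]
  have hSbot : S = ⊥ := by
    by_contra hne
    obtain ⟨z, hzS, hz0, μ, hμ⟩ := exists_common_eigenvector
      (fun j => (opDetQuot V₀ V j).mulVecLin) (fun j l => by
        have := opDetQuot_commute (V₀ := V₀) hV j l
        rw [Commute, SemiconjBy, Module.End.mul_eq_comp, Module.End.mul_eq_comp, ← mulVecLin_mul,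
          ← mulVecLin_mul, this.eq]) S hne (fun j z hz => by
        rw [hS] at hz ⊢
        rw [mulVecLin_apply]
        refine ⟨?_, ?_⟩
        · rw [mulVec_mulVec, (opDetQuot_commute hV i j).eq, ← mulVec_mulVec, hz.1, mulVec_smul]
        · rw [mulVec_mulVec, opDet_mul_opDetQuot hV, dotProduct_mulVec, hleft, smul_dotProduct,
            ← dotProduct_mulVec, hz.2, smul_zero])
    have hμ' : ∀ j, opDetQuot V₀ V j *ᵥ z = μ j • z := hμ
    rw [hS] at hzS
    have hslot := slot_linEval_mulVec_eq_zero hV hμ'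
    have hμi : μ i = x i := smul_left_injective ℂ hz0 ((hμ' i).symm.trans hzS.1)
    have hμx : μ = x := huniq μ (fun k => det_eq_zero_of_slot_mulVec hz0 (hslot k)) hμi
    subst hμx
    obtain ⟨c, rfl⟩ := exists_eq_smul_kronVec hu hv huW hvW hadj hslot
    have h := hzS.2
    rw [mulVec_smul, dotProduct_smul, smul_eq_mul] at h
    have hc : c = 0 := (mul_eq_zero.1 h).resolve_right hβ
    exact hz0 (by simp [hc])
  -- Chosen so that `w - c • kronVec v` is annihilated by `yᵀ Δ₀`, hence lies in `S = ⊥`.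
  set c := (y ⬝ᵥ opDet V *ᵥ w) / (y ⬝ᵥ opDet V *ᵥ kronVec v) with hc
  refine ⟨c, ?_⟩
  rw [← sub_eq_zero, ← Submodule.mem_bot ℂ, ← hSbot, hS]
  refine ⟨hquot _ ?_, ?_⟩
  · rw [mulVec_sub, hw, mulVec_smul, (isRightEigenvector_kronVec hv hvW i).2, smul_zero, sub_zero]
  · rw [mulVec_sub, mulVec_smul, dotProduct_sub, dotProduct_smul, smul_eq_mul, hc,
      div_mul_cancel₀ _ hβ, sub_self]

end Commuting

/-! ### Partial derivatives of a determinantal representation -/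

section Jacobian

variable {d m : ℕ} {V₀ : Matrix (Fin m) (Fin m) ℂ} {V : Fin d → Matrix (Fin m) (Fin m) ℂ}
  {x : Fin d → ℂ}

theorem linPoly_map_eval :
    (linPoly V₀ V).map (MvPolynomial.eval x) = linEval V₀ V x := by
  ext a b
  simp [linPoly, linEval, Matrix.sum_apply]

theorem eval_det_linPoly :
    MvPolynomial.eval x (linPoly V₀ V).det = (linEval V₀ V x).det := by
  rw [RingHom.map_det, RingHom.mapMatrix_apply, linPoly_map_eval]

theorem linPoly_map_pderiv (j : Fin d) :
    (linPoly V₀ V).map (MvPolynomial.pderiv j) = -(V j).map MvPolynomial.C := by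
  ext1 a b
  simp [linPoly, Matrix.sum_apply, Pi.single_apply]

theorem eval_pderiv_det_linPoly (j : Fin d) :
    MvPolynomial.eval x (MvPolynomial.pderiv j (linPoly V₀ V).det) =
      -((linEval V₀ V x).adjugate * V j).trace := by
  have h : ((V j).map MvPolynomial.C).map (MvPolynomial.eval x) = V j := by
    ext a b
    simp
  rw [derivation_det, linPoly_map_pderiv, mul_neg, trace_neg, map_neg, map_trace_adjugate_mul,
    linPoly_map_eval, h]

end Jacobian

/-! ### The Jacobian in terms of `B₀`, and the main theorem -/

section Main

variable {d : ℕ} {n : Fin d → ℕ} {p : Fin d → MvPolynomial (Fin d) ℂ}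
  {V₀ : (k : Fin d) → Matrix (Fin (n k)) (Fin (n k)) ℂ}
  {V : (k : Fin d) → Fin d → Matrix (Fin (n k)) (Fin (n k)) ℂ} {x : Fin d → ℂ}

/-- By Jacobi's formula a vanishing adjugate would make row `k` of the Jacobian zero. -/
theorem adjugate_linEval_ne_zero (hp : ∀ k, (linPoly (V₀ k) (V k)).det = p k)
    (hx : IsSimpleRoot p x) (k : Fin d) : (linEval (V₀ k) (V k) x).adjugate ≠ 0 := by
  intro h
  refine hx.2 (det_eq_zero_of_row_eq_zero k fun j => ?_)
  rw [jacobian, of_apply, ← hp, eval_pderiv_det_linPoly, h, zero_mul, trace_zero, neg_zero]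

theorem det_jacobian (hp : ∀ k, (linPoly (V₀ k) (V k)).det = p k)
    {u v : (k : Fin d) → Fin (n k) → ℂ} {c : Fin d → ℂ}
    (hc : ∀ k, (linEval (V₀ k) (V k) x).adjugate = c k • vecMulVec (v k) (u k)) :
    (jacobian p x).det = (∏ k, -c k) * (matB₀ V u v).det := by
  rw [← det_mul_column]
  congr 1
  ext k j
  rw [jacobian, of_apply, ← hp, eval_pderiv_det_linPoly, hc, smul_mul_assoc, trace_smul,
    vecMulVec_mul, trace_vecMulVec, dotProduct_comm, ← dotProduct_mulVec, of_apply, smul_eq_mul,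
    neg_mul]
  rfl

end Main

end OpDet

theorem mainTheorem2 {d : ℕ} (n : Fin d → ℕ)
    (p : Fin d → MvPolynomial (Fin d) ℂ)
    (V₀ : (k : Fin d) → Matrix (Fin (n k)) (Fin (n k)) ℂ)
    (V : (k : Fin d) → Fin d → Matrix (Fin (n k)) (Fin (n k)) ℂ)
    (hp : ∀ k, (OpDet.linPoly (V₀ k) (V k)).det = p k)
    (x : Fin d → ℂ) (hx : OpDet.IsSimpleRoot p x)
    (u v : (k : Fin d) → Fin (n k) → ℂ)
    (hu : ∀ k, OpDet.vecNorm (u k) = 1)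
    (hv : ∀ k, OpDet.vecNorm (v k) = 1)
    (huW : ∀ k, Matrix.vecMul (u k) (OpDet.linEval (V₀ k) (V k) x) = 0)
    (hvW : ∀ k, (OpDet.linEval (V₀ k) (V k) x).mulVec (v k) = 0) :
    -- each `W_k(x)` has exactly `n_k - 1` nonzero singular values
    (∀ k, (∀ j < n k - 1, 0 < OpDet.singVal (OpDet.linEval (V₀ k) (V k) x) j) ∧
      OpDet.singVal (OpDet.linEval (V₀ k) (V k) x) (n k - 1) = 0) ∧
    -- `B₀` is invertible, and its determinant is related to the Jacobian
    (OpDet.matB₀ V u v).det ≠ 0 ∧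
    ‖(OpDet.matB₀ V u v).det‖⁻¹ =
      (∏ k, ∏ j ∈ Finset.range (n k - 1), OpDet.singVal (OpDet.linEval (V₀ k) (V k) x) j) /
        ‖(OpDet.jacobian p x).det‖ ∧
    ∀ i : Fin d,
      -- the Kronecker products are eigenvectors of `Δ_i z = x_i Δ_0 z`
      OpDet.IsLeftEigenvector (OpDet.opDetCol V₀ V i) (OpDet.opDet V) (x i) (OpDet.kronVec u) ∧
      OpDet.IsRightEigenvector (OpDet.opDetCol V₀ V i) (OpDet.opDet V) (x i) (OpDet.kronVec v) ∧
      -- the eigenvector expression for the condition number at these eigenvectors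
      OpDet.eigCondAt (OpDet.opDet V) (x i) (OpDet.kronVec u) (OpDet.kronVec v) =
        ‖(OpDet.matB₀ V u v).det‖⁻¹ * (1 + ‖x i‖) ∧
      -- the condition number at a simple eigenvalue
      (OpDet.IsSimpleEigenvalue (OpDet.opDetCol V₀ V i) (OpDet.opDet V) (x i) →
        OpDet.eigCond (OpDet.opDetCol V₀ V i) (OpDet.opDet V) (x i) =
            ENNReal.ofReal (‖(OpDet.matB₀ V u v).det‖⁻¹ * (1 + ‖x i‖)) ∧
        OpDet.eigCond (OpDet.opDetCol V₀ V i) (OpDet.opDet V) (x i) =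
            ENNReal.ofReal
              ((∏ k, ∏ j ∈ Finset.range (n k - 1),
                  OpDet.singVal (OpDet.linEval (V₀ k) (V k) x) j) /
                ‖(OpDet.jacobian p x).det‖ * (1 + ‖x i‖))) ∧
      -- `x_i` is a simple eigenvalue if `Δ_0` is invertible and no other root shares `x_i`
      ((OpDet.opDet V).det ≠ 0 →
        (∀ x' : Fin d → ℂ, OpDet.IsRoot p x' → x' i = x i → x' = x) →
        OpDet.IsSimpleEigenvalue (OpDet.opDetCol V₀ V i) (OpDet.opDet V) (x i)) := by
  have hadj := OpDet.adjugate_linEval_ne_zero hp hx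
  have hc := fun k => OpDet.exists_adjugate_eq_smul (hadj k) (OpDet.ne_zero_of_vecNorm (hu k))
    (OpDet.ne_zero_of_vecNorm (hv k)) (huW k) (hvW k)
  choose c hc0 hc using hc
  have hsing := fun k => OpDet.singVal_of_adjugate_ne_zero (hu k) (hv k) (hvW k) (hadj k) (hc k)
  have hJ := OpDet.det_jacobian hp hc
  have hB : (OpDet.matB₀ V u v).det ≠ 0 := fun h => hx.2 (by rw [hJ, h, mul_zero])
  have hc' : ‖∏ k, -c k‖ ≠ 0 :=
    norm_ne_zero_iff.2 (Finset.prod_ne_zero_iff.2 fun k _ => neg_ne_zero.2 (hc0 k))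
  have hprod : ∏ k, ∏ j ∈ Finset.range (n k - 1),
      OpDet.singVal (OpDet.linEval (V₀ k) (V k) x) j = ‖∏ k, -c k‖ := by
    rw [norm_prod]
    exact Finset.prod_congr rfl fun k _ => by rw [(hsing k).2.2, norm_neg]
  have hB' : ‖(OpDet.matB₀ V u v).det‖⁻¹ =
      (∏ k, ∏ j ∈ Finset.range (n k - 1), OpDet.singVal (OpDet.linEval (V₀ k) (V k) x) j) /
        ‖(OpDet.jacobian p x).det‖ := by
    rw [hprod, hJ, norm_mul]
    field_simp
  refine ⟨fun k => ⟨(hsing k).1, (hsing k).2.1⟩, hB, hB', fun i => ?_⟩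
  have hleft := OpDet.isLeftEigenvector_kronVec hu huW i
  have hright := OpDet.isRightEigenvector_kronVec hv hvW i
  have hu1 := OpDet.vecNorm_kronVec hu
  have hv1 := OpDet.vecNorm_kronVec hv
  have hβ := OpDet.kronVec_dotProduct_opDet_mulVec V u v
  refine ⟨hleft, hright, ?_, fun hs => ?_, fun hV huniq => ?_⟩
  · rw [OpDet.eigCondAt, hu1, hv1, hβ, one_mul, one_div]
  · have h := OpDet.eigCond_of_isSimpleEigenvalue hu1 hv1 hleft hright (by rwa [hβ]) hs
    rw [hβ] at h
    exact ⟨h, by rw [h, hB']⟩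
  · refine OpDet.isSimpleEigenvalue_of_ker hleft hright (by rwa [hβ]) fun w hw => ?_
    refine OpDet.ker_opDetCol_sub_smul hV hu hv huW hvW hadj hB i (fun x' hx' => ?_) hw
    exact huniq x' fun k => by rw [← hp, OpDet.eval_det_linPoly, hx' k]
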